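/- **Setting.** For $n\ge 1$ let $\theta=(\rho,\gamma,\alpha_1,\beta_1,\dots,\alpha_n,\beta_n)$ be real parameters with $\sum_i\alpha_i=\sum_i\beta_i=0$. In the $p_1$ model, $A\in\{0,1\}^{n\times n}$ is the adjacency matrix of a random directed graph, $A_{ii}=0$, the pairs $(A_{ij},A_{ji})$, $i<j$, are independent, and for $a,b\in\{0,1\}$ $$\mathbb P_\theta(A_{ij}=a,A_{ji}=b)=K_{ij}\exp\big(a(\gamma+\alpha_i+\beta_j)+b(\gamma+\alpha_j+\beta_i)+ab\rho\big),$$ $$K_{ij}=\big[1+e^{\gamma+\alpha_i+\beta_j}+e^{\gamma+\alpha_j+\beta_i}+e^{2\gamma+\alpha_i+\beta_j+\alpha_j+\beta_i+\rho}\big]^{-1}.$$ Put $\mu_i=e^{\gamma/2+\alpha_i}$, $\nu_i=e^{\gamma/2+\beta_i}$, $\eta_i=\mu_i\nu_i$; $x_{\max}$ is the largest entry of a vector $x$, $\|x\|_1$ its $\ell^1$-norm, $(x,y)$ the inner product. Let $$r_n(\theta)=\max\Big\{\frac1{e^\rho\|\eta\|_1^2},\ \frac{(\mu,\eta)(\nu,\eta)}{\|\eta\|_1^4}\Big\},\qquad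 \tilde\rho=\log\frac{\|\eta\|_1^2}{(\mu,\eta)(\nu,\eta)}.$$ **Parameter class.** Let $\Theta_0$ be the set of $\theta$ with $$\min\Big\{\frac1{\mu_{\max}},\frac1{\nu_{\max}},\frac1{e^{\rho/2}\eta_{\max}},\frac{\|\eta\|_1}{\log^2 n},\frac{e^{\rho/2}\|\eta\|_1}{\sqrt{\log n}},\frac{(\mu,\eta)(\nu,\eta)}{\mu_{\max}^2\nu_{\max}^2}\Big\}\ge\log\log n .$$ Fix constants $c_L>0$ and $\kappa\ge1$. For $\epsilon>0$ let $\Theta(\epsilon)$ be the set of $\theta\in\Theta_0$ such that $r_n(\theta)\le\epsilon$ and, if $e^\rho\ge c_Le^{\tilde\rho}$ (Case (L)), then $\kappa^{-1}\|\nu\|_1\le\|\mu\|_1\le\kappa\|\nu\|_1$. **Estimator.** Let $\circ$ be the entrywise product, $\tilde J$ the $n\times n$ matrix with zero diagonal and all other entries $1$, $A^{11}=A\circ A'$, $A^{00}=(\tilde J-A)\circ(\tilde J-A')$, $A^{10}=A\circ(\tilde J-A')$, $A^{01}=(A^{10})'$, and, summing over distinct $i,j,k,\ell$, $$Q_n(a)=\sum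 A^{11}_{ij}A^{00}_{jk}A^{01}_{k\ell}A^{00}_{\ell i},\qquad Q_n(b)=\sum A^{10}_{ij}A^{10}_{jk}A^{00}_{k\ell}A^{10}_{\ell i}.$$ The LCR estimator is $\hat\rho^*=H(\log(Q_n(a)/Q_n(b));2\log n)$, where $H(x;t)=x$ if $|x|\le t$ and $H(x;t)=\mathrm{sign}(x)\,t$ otherwise (with $\log 0=-\infty$, $\log\infty=+\infty$, and $\hat\rho^*=0$ if both counts vanish). **Risks.** $R_n^*(\epsilon)=\inf_{\hat\rho}\sup_{\theta\in\Theta(\epsilon)}\mathbb E_\theta[(\hat\rho-\rho)^2]$, the infimum being over all real-valued functions $\hat\rho=\hat\rho(A)$, and $R_n(\hat\rho^*;\epsilon)=\sup_{\theta\in\Theta(\epsilon)}\mathbb E_\theta[(\hat\rho^*-\rho)^2]$. **Theorem 3.3.** For all $c_L>0$ and $\kappa\ge1$ there are constants $c,C>0$, depending only on $c_L$ and $\kappa$, such that the following holds. 1. For all sufficiently large $n$ and all $\epsilon_n$ with $(\log\log n/n)^2\le\epsilon_n\le 1/(\log n\,[\log\log n]^2)$, $$R_n^*(\epsilon_n)\le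 R_n(\hat\rho^*;\epsilon_n)\le C\epsilon_n .$$ 2. For every $\delta>0$, for all sufficiently large $n$ (how large may depend on $\delta$) and all $\epsilon_n$ with $(1+\delta)(\log\log n/n)^2\le\epsilon_n\le 1/(\log n\,[\log\log n]^2)$, $$R_n^*(\epsilon_n)\ge c\,\epsilon_n .$$ Hence, for every fixed $\delta>0$, $c\,\epsilon_n\le R_n^*(\epsilon_n)\le R_n(\hat\rho^*;\epsilon_n)\le C\epsilon_n$ for all large $n$ throughout the range in part 2, so the LCR estimator is asymptotically minimax (rate optimal) for $\rho$. -/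

import Mathlib

open MeasureTheory Filter
open scoped ENNReal Matrix

noncomputable section

/-- Parameters `θ = (ρ, γ, α₁, β₁, …, αₙ, βₙ)` of the `p₁` model on `n` nodes, with the
identifiability constraints `∑ αᵢ = ∑ βᵢ = 0`. -/
structure P1Param (n : ℕ) where
  ρ : ℝ
  γ : ℝ
  α : Fin n → ℝ
  β : Fin n → ℝ
  sum_α : ∑ i, α i = 0
  sum_β : ∑ i, β i = 0

namespace P1Param

variable {n : ℕ} (θ : P1Param n)

/-- The normalizing constant `K_{ij}`. -/
def K (i j : Fin n) : ℝ :=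
  (1 + Real.exp (θ.γ + θ.α i + θ.β j) + Real.exp (θ.γ + θ.α j + θ.β i)
    + Real.exp (2 * θ.γ + θ.α i + θ.β j + θ.α j + θ.β i + θ.ρ))⁻¹

/-- `P(A_{ij} = a, A_{ji} = b)`, for `(a, b) ∈ {0,1}²`. -/
def dyadProb (i j : Fin n) (ab : Bool × Bool) : ℝ :=
  θ.K i j * Real.exp ((ab.1.toNat : ℝ) * (θ.γ + θ.α i + θ.β j)
    + (ab.2.toNat : ℝ) * (θ.γ + θ.α j + θ.β i)
    + (ab.1.toNat : ℝ) * (ab.2.toNat : ℝ) * θ.ρ)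

lemma K_nonneg (i j : Fin n) : 0 ≤ θ.K i j := by
  unfold K; positivity

lemma dyadProb_nonneg (i j : Fin n) (ab : Bool × Bool) : 0 ≤ θ.dyadProb i j ab :=
  mul_nonneg (θ.K_nonneg i j) (Real.exp_pos _).le

lemma sum_dyadProb (i j : Fin n) : ∑ ab, θ.dyadProb i j ab = 1 := by
  have h : 0 < 1 + Real.exp (θ.γ + θ.α i + θ.β j) + Real.exp (θ.γ + θ.α j + θ.β i)
      + Real.exp (2 * θ.γ + θ.α i + θ.β j + θ.α j + θ.β i + θ.ρ) := by positivity
  have e : θ.γ + θ.α i + θ.β j + (θ.γ + θ.α j + θ.β i) + θ.ρ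
      = 2 * θ.γ + θ.α i + θ.β j + θ.α j + θ.β i + θ.ρ := by ring
  simp only [dyadProb, ← Finset.mul_sum, K]
  rw [inv_mul_eq_one₀ h.ne']
  simp [Fintype.sum_prod_type, e]
  ring

/-- The bivariate Bernoulli law of `(A_{ij}, A_{ji})`. -/
def dyadPMF (i j : Fin n) : PMF (Bool × Bool) :=
  PMF.ofFintype (fun ab => ENNReal.ofReal (θ.dyadProb i j ab)) (by
    rw [← ENNReal.ofReal_sum_of_nonneg fun ab _ => θ.dyadProb_nonneg i j ab,
      θ.sum_dyadProb, ENNReal.ofReal_one])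

end P1Param

/-- The unordered pairs of distinct nodes, listed as `i < j`. -/
abbrev Dyad (n : ℕ) : Type := {p : Fin n × Fin n // p.1 < p.2}

/-- A configuration gives the value of `(A_{ij}, A_{ji})` for every pair `i < j`. -/
abbrev Config (n : ℕ) : Type := Dyad n → Bool × Bool

/-- The adjacency matrix of a configuration: entries `0` or `1`, zero diagonal. -/
def adjacency {n : ℕ} (ω : Config n) : Matrix (Fin n) (Fin n) ℝ := fun i j =>
  if h : i < j then ((ω ⟨(i, j), h⟩).1.toNat : ℝ)
  else if h : j < i then ((ω ⟨(j, i), h⟩).2.toNat : ℝ)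
  else 0

namespace P1Param

variable {n : ℕ} (θ : P1Param n)

/-- The `p₁` model: the pairs `(A_{ij}, A_{ji})`, `i < j`, are independent with laws
`dyadPMF i j`. -/
def law : Measure (Config n) :=
  Measure.pi fun d : Dyad n => (θ.dyadPMF d.1.1 d.1.2).toMeasure

/-- Mean squared error `E_θ[(T(A) - ρ)²]` of an estimator `T` of `ρ`. The sample space is finite
and discrete, so that no measurability condition on `T` is needed. -/
def mse (T : Matrix (Fin n) (Fin n) ℝ → ℝ) : ℝ≥0∞ :=
  ∫⁻ ω, ENNReal.ofReal ((T (adjacency ω) - θ.ρ) ^ 2) ∂θ.law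

/-- `μ_i = exp(γ/2 + α_i)`. -/
def mu (i : Fin n) : ℝ := Real.exp (θ.γ / 2 + θ.α i)

/-- `ν_i = exp(γ/2 + β_i)`. -/
def nu (i : Fin n) : ℝ := Real.exp (θ.γ / 2 + θ.β i)

/-- `η_i = μ_i ν_i`. -/
def eta (i : Fin n) : ℝ := θ.mu i * θ.nu i

end P1Param

/-- The `ℓ¹` norm. -/
def l1norm {n : ℕ} (x : Fin n → ℝ) : ℝ := ∑ i, |x i|

/-- The largest entry of a vector. -/
def maxEntry {n : ℕ} (x : Fin n → ℝ) : ℝ := ⨆ i, x i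

namespace P1Param

variable {n : ℕ} (θ : P1Param n)

/-- `r_n(θ) = max {1 / (e^ρ ‖η‖₁²), (μ, η)(ν, η) / ‖η‖₁⁴}`. -/
def rate : ℝ :=
  max (1 / (Real.exp θ.ρ * l1norm θ.eta ^ 2))
    ((θ.mu ⬝ᵥ θ.eta) * (θ.nu ⬝ᵥ θ.eta) / l1norm θ.eta ^ 4)

/-- `ρ̃ = log (‖η‖₁² / ((μ, η)(ν, η)))`. -/
def rhoTilde : ℝ :=
  Real.log (l1norm θ.eta ^ 2 / ((θ.mu ⬝ᵥ θ.eta) * (θ.nu ⬝ᵥ θ.eta)))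

end P1Param

/-- The regular class `Θ₀`: the six quantities below are all at least `log log n`. -/
def Theta0 (n : ℕ) : Set (P1Param n) :=
  {θ | Real.log (Real.log n) ≤ 1 / maxEntry θ.mu ∧
    Real.log (Real.log n) ≤ 1 / maxEntry θ.nu ∧
    Real.log (Real.log n) ≤ 1 / (Real.exp (θ.ρ / 2) * maxEntry θ.eta) ∧
    Real.log (Real.log n) ≤ l1norm θ.eta / Real.log n ^ 2 ∧
    Real.log (Real.log n) ≤ Real.exp (θ.ρ / 2) * l1norm θ.eta / √(Real.log n) ∧
    Real.log (Real.log n) ≤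
      (θ.mu ⬝ᵥ θ.eta) * (θ.nu ⬝ᵥ θ.eta) / (maxEntry θ.mu ^ 2 * maxEntry θ.nu ^ 2)}

/-- The class `Θ(ε)`. Here `cL` is the constant that delimits Case (L), `e^ρ ≥ cL e^ρ̃`, and `κ` is
the constant in the requirement `‖μ‖₁ ≍ ‖ν‖₁` imposed in that case only. -/
def Theta (cL κ : ℝ) (n : ℕ) (ε : ℝ) : Set (P1Param n) :=
  {θ | θ ∈ Theta0 n ∧ θ.rate ≤ ε ∧
    (cL * Real.exp θ.rhoTilde ≤ Real.exp θ.ρ →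
      l1norm θ.nu / κ ≤ l1norm θ.mu ∧ l1norm θ.mu ≤ κ * l1norm θ.nu)}

/-- `R_n(T; ε)`: worst-case mean squared error of `T` over `Θ(ε)`. -/
def worstRisk (cL κ : ℝ) (n : ℕ) (ε : ℝ) (T : Matrix (Fin n) (Fin n) ℝ → ℝ) : ℝ≥0∞ :=
  ⨆ θ ∈ Theta cL κ n ε, P1Param.mse θ T

/-- `R_n^*(ε)`: minimax risk over `Θ(ε)`, the infimum being over all estimators. -/
def minimaxRisk (cL κ : ℝ) (n : ℕ) (ε : ℝ) : ℝ≥0∞ :=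
  ⨅ T : Matrix (Fin n) (Fin n) ℝ → ℝ, worstRisk cL κ n ε T

section Estimator

variable {n : ℕ} (A : Matrix (Fin n) (Fin n) ℝ)

/-- `J - I`, with `J` the matrix of ones. -/
def Jtilde (n : ℕ) : Matrix (Fin n) (Fin n) ℝ := Matrix.of (fun _ _ => 1) - 1

/-- Double edges. -/
def A11 : Matrix (Fin n) (Fin n) ℝ := A ⊙ Aᵀ

/-- No edge. -/
def A00 : Matrix (Fin n) (Fin n) ℝ := (Jtilde n - A) ⊙ (Jtilde n - Aᵀ)

/-- An edge `i → j` and no edge `j → i`. -/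
def A10 : Matrix (Fin n) (Fin n) ℝ := A ⊙ (Jtilde n - Aᵀ)

/-- An edge `j → i` and no edge `i → j`. -/
def A01 : Matrix (Fin n) (Fin n) ℝ := (A10 A)ᵀ

/-- The four indices are distinct. -/
abbrev Dist4 (i j k l : Fin n) : Prop :=
  i ≠ j ∧ i ≠ k ∧ i ≠ l ∧ j ≠ k ∧ j ≠ l ∧ k ≠ l

/-- `Q_n(a)`. -/
def Qa : ℝ := ∑ i, ∑ j, ∑ k, ∑ l,
  if Dist4 i j k l then A11 A i j * A00 A j k * A01 A k l * A00 A l i else 0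

/-- `Q_n(b)`. -/
def Qb : ℝ := ∑ i, ∑ j, ∑ k, ∑ l,
  if Dist4 i j k l then A10 A i j * A10 A j k * A00 A k l * A10 A l i else 0

/-- The thresholding operator `H(x; t)`. -/
def H (x t : ℝ) : ℝ := if |x| ≤ t then x else Real.sign x * t

/-- The LCR estimator `H(log (Q_n(a) / Q_n(b)); 2 log n)`. When exactly one count vanishes, the
logarithm is `±∞` and `H` returns `± 2 log n`; the undefined case `0 / 0` is given the value `0`. -/
def lcr : ℝ :=
  if Qa A = 0 ∧ Qb A = 0 then 0
  else if Qb A = 0 then 2 * Real.log n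
  else if Qa A = 0 then -(2 * Real.log n)
  else H (Real.log (Qa A / Qb A)) (2 * Real.log n)

end Estimator

end

/-! Upper bound. Around a fixed four-cycle the two patterns carry the same normalizing constants,
and their remaining exponentials differ exactly by the factor e^ρ. Hence E Q_n(a) = e^ρ E Q_n(b)
(`P1Param.Ex_cycleCount_patternA`), and log(Q_n(a)/Q_n(b)) - ρ is the difference of the logarithms
of the two counts divided by their means. Where both ratios exceed a fixed constant, the loss is at
most a multiple of the squared relative deviations, whose mean is O(r_n(θ))
(`PatternControl.relative_variance_le`). Elsewhere the loss is at most 16 log² n, because |ρ| ≤ 2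
log n on Θ₀. That event has probability O(r_n³), and r_n log n ≤ 1 makes its contribution O(r_n).

Both moment estimates rest on colouring the vertices. If the corners of the cycles must have four
prescribed distinct colours, two cycles can share a dyad only in the same position, so mixed moments
factorise over the positions (`P1Param.Ex_cycleInd_mul_le`) and the variance becomes a combination
of products of vertex sums, controlled by Cauchy–Schwarz (`NormRelations`). The full count is 4⁴
times the average of the coloured counts over uniform colourings, so Jensen's inequality transfers
the variance bound (`P1Param.variance_cycleCount_le`). For the tail, twelve colours in three groups
of four give three independent coloured counts, each of mean comparable to the full one if the
colouring is balanced (`exists_balanced_colouring`). A small full count makes all three small, and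
Chebyshev's bound is cubed (`PatternControl.lower_tail_le`).

Lower bound. Le Cam's method is applied to two homogeneous parameters with μ_i = ν_i = 1/log log n,
e^ρ ‖η‖₁² = 1/ε, and ρ' = ρ + 2 log(1 + √ε). The number of double edges is of order 1/ε, so changing
e^ρ by a relative amount of order √ε keeps the Hellinger affinity bounded below
(`P1Param.exp_neg_le_homogeneous_affinity_sq`). The factor 1 + δ leaves room for ρ' in the parameter
class. -/

noncomputable section

/-! ### Expectation over independent finite coordinates. -/

section ProductExpectation

variable {ι σ : Type*} [Fintype ι] [DecidableEq ι] [Fintype σ]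

/-- Expectation over independent coordinates `ω d` with laws `p d` on a finite set. -/
def Ex (p : ι → σ → ℝ) (F : (ι → σ) → ℝ) : ℝ := ∑ ω, (∏ d, p d (ω d)) * F ω

/-- Each `p d` is a probability vector. -/
structure IsProbFamily (p : ι → σ → ℝ) : Prop where
  nonneg : ∀ d s, 0 ≤ p d s
  sum_eq : ∀ d, ∑ s, p d s = 1

lemma Ex_prod (p f : ι → σ → ℝ) :
    Ex p (fun ω => ∏ d, f d (ω d)) = ∏ d, ∑ s, p d s * f d s := by
  simp only [Ex, ← Finset.prod_mul_distrib]
  rw [Finset.prod_univ_sum, Fintype.piFinset_univ]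

lemma Ex_add (p : ι → σ → ℝ) (F G : (ι → σ) → ℝ) :
    Ex p (fun ω => F ω + G ω) = Ex p F + Ex p G := by
  simp only [Ex, mul_add, Finset.sum_add_distrib]

lemma Ex_sub (p : ι → σ → ℝ) (F G : (ι → σ) → ℝ) :
    Ex p (fun ω => F ω - G ω) = Ex p F - Ex p G := by
  simp only [Ex, mul_sub, Finset.sum_sub_distrib]

lemma Ex_const_mul (p : ι → σ → ℝ) (c : ℝ) (F : (ι → σ) → ℝ) :
    Ex p (fun ω => c * F ω) = c * Ex p F := by
  simp only [Ex, Finset.mul_sum]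
  exact Finset.sum_congr rfl fun ω _ => by ring

lemma Ex_sum {κ : Type*} (p : ι → σ → ℝ) (s : Finset κ) (F : κ → (ι → σ) → ℝ) :
    Ex p (fun ω => ∑ k ∈ s, F k ω) = ∑ k ∈ s, Ex p (F k) := by
  simp only [Ex, Finset.mul_sum]
  exact Finset.sum_comm

namespace IsProbFamily

variable {p : ι → σ → ℝ} (hp : IsProbFamily p)
include hp

omit [DecidableEq ι] in
lemma weight_nonneg (ω : ι → σ) : 0 ≤ ∏ d, p d (ω d) :=
  Finset.prod_nonneg fun d _ => hp.nonneg d _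

lemma Ex_mono {F G : (ι → σ) → ℝ} (h : ∀ ω, F ω ≤ G ω) : Ex p F ≤ Ex p G :=
  Finset.sum_le_sum fun ω _ => mul_le_mul_of_nonneg_left (h ω) (hp.weight_nonneg ω)

lemma Ex_nonneg {F : (ι → σ) → ℝ} (h : ∀ ω, 0 ≤ F ω) : 0 ≤ Ex p F :=
  Finset.sum_nonneg fun ω _ => mul_nonneg (hp.weight_nonneg ω) (h ω)

lemma sum_weight : ∑ ω : ι → σ, ∏ d, p d (ω d) = 1 := by
  have := Ex_prod p (fun _ _ => (1 : ℝ))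
  simpa [Ex, hp.sum_eq] using this

lemma Ex_const (c : ℝ) : Ex p (fun _ => c) = c := by
  simp only [Ex, ← Finset.sum_mul, hp.sum_weight, one_mul]

-- The weights need not be normalized here, so the two factors are not yet expectations. Taking `F`
-- or `G` constant recovers the normalization. Coordinates that do not matter are filled with
-- `default`.
omit hp in
lemma Ex_mul_eq_sum_mul_sum [Inhabited σ] (D : Set ι) [DecidablePred (· ∈ D)]
    {F G : (ι → σ) → ℝ} (hF : DependsOn F D) (hG : DependsOn G Dᶜ) :
    let e := Equiv.piEquivPiSubtypeProd (· ∈ D) (fun _ => σ)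
    Ex p (fun ω => F ω * G ω) =
      (∑ x, (∏ d : {d // d ∈ D}, p d (x d)) * F (e.symm (x, default))) *
        ∑ y, (∏ d : {d // d ∉ D}, p d (y d)) * G (e.symm (default, y)) := by
  intro e
  rw [Ex, Finset.sum_mul_sum, ← e.symm.sum_comp, Fintype.sum_prod_type]
  refine Finset.sum_congr rfl fun x _ => Finset.sum_congr rfl fun y _ => ?_
  have h1 : F (e.symm (x, y)) = F (e.symm (x, default)) :=
    hF fun i hi => by simp [e, Equiv.piEquivPiSubtypeProd, hi]
  have h2 : G (e.symm (x, y)) = G (e.symm (default, y)) :=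
    hG fun i hi => by
      have : i ∉ D := hi
      simp [e, Equiv.piEquivPiSubtypeProd, this]
  have h3 : ∏ d, p d (e.symm (x, y) d) =
      (∏ d : {d // d ∈ D}, p d (x d)) * ∏ d : {d // d ∉ D}, p d (y d) := by
    rw [← Fintype.prod_subtype_mul_prod_subtype (· ∈ D)]
    congr 1
    · exact Finset.prod_congr rfl fun d _ => by simp [e, Equiv.piEquivPiSubtypeProd, d.2]
    · exact Finset.prod_congr rfl fun d _ => by simp [e, Equiv.piEquivPiSubtypeProd, d.2]
  rw [h1, h2, h3]; ring

/-- Functions of disjoint sets of coordinates are uncorrelated. -/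
lemma Ex_mul_of_dependsOn [Inhabited σ] {D D' : Set ι} (hD : Disjoint D D')
    {F G : (ι → σ) → ℝ} (hF : DependsOn F D) (hG : DependsOn G D') :
    Ex p (fun ω => F ω * G ω) = Ex p F * Ex p G := by
  classical
  have hG' : DependsOn G Dᶜ := fun x y h => hG fun i hi => h i (hD.notMem_of_mem_right hi)
  have h1 := Ex_mul_eq_sum_mul_sum (p := p) D hF hG'
  have h2 := Ex_mul_eq_sum_mul_sum (p := p) D hF (G := fun _ => 1) (fun _ _ _ => rfl)
  have h3 := Ex_mul_eq_sum_mul_sum (p := p) D (F := fun _ => 1) (fun _ _ _ => rfl) hG'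
  have h4 := Ex_mul_eq_sum_mul_sum (p := p) D (F := fun _ => 1) (G := fun _ => 1)
    (fun _ _ _ => rfl) (fun _ _ _ => rfl)
  simp only [mul_one, one_mul, hp.Ex_const] at h1 h2 h3 h4
  rw [h1, h2, h3]
  -- `h4` says that the total masses on the two sides of the split multiply to 1.
  linear_combination (∑ x : {d // d ∈ D} → σ, (∏ d : {d // d ∈ D}, p d (x d)) *
      F ((Equiv.piEquivPiSubtypeProd (· ∈ D) (fun _ => σ)).symm (x, default))) *
    (∑ y : {d // d ∉ D} → σ, (∏ d : {d // d ∉ D}, p d (y d)) *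
      G ((Equiv.piEquivPiSubtypeProd (· ∈ D) (fun _ => σ)).symm (default, y))) * h4

lemma Ex_coord (d : ι) (g : σ → ℝ) : Ex p (fun ω => g (ω d)) = ∑ s, p d s * g s := by
  have h := Ex_prod p (fun e s => if e = d then g s else 1)
  have h1 : ∀ ω : ι → σ, (∏ e, if e = d then g (ω e) else 1) = g (ω d) := fun ω => by simp
  simp only [h1] at h
  rw [h, Finset.prod_eq_single d]
  · simp
  · intro e _ he; simp [he, hp.sum_eq]
  · simp

lemma Ex_variance (F : (ι → σ) → ℝ) :
    Ex p (fun ω => (F ω - Ex p F) ^ 2) = Ex p (fun ω => F ω ^ 2) - Ex p F ^ 2 := by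
  have : ∀ ω, (F ω - Ex p F) ^ 2 = F ω ^ 2 - (2 * Ex p F) * F ω + Ex p F ^ 2 := fun ω => by ring
  simp only [this]
  rw [Ex_add, Ex_sub, Ex_const_mul, hp.Ex_const]; ring

/-- Chebyshev's inequality for the lower tail. -/
lemma Ex_lower_tail {F : (ι → σ) → ℝ} {t m : ℝ} (htm : t < m) :
    Ex p (fun ω => if F ω < t then 1 else 0) ≤
      Ex p (fun ω => (F ω - m) ^ 2) / (m - t) ^ 2 := by
  have h0 : 0 < m - t := sub_pos.2 htm
  rw [div_eq_inv_mul, ← Ex_const_mul]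
  refine hp.Ex_mono fun ω => ?_
  rw [← div_eq_inv_mul]
  split_ifs with h
  · rw [one_le_div (by positivity)]
    nlinarith
  · positivity

end IsProbFamily

end ProductExpectation

/-! ### The law of the graph and the mean squared error as finite sums. -/

namespace P1Param

variable {n : ℕ} (θ : P1Param n)

/-- The laws of the dyads. -/
def dyadLaw (d : Dyad n) (s : Bool × Bool) : ℝ := θ.dyadProb d.1.1 d.1.2 s

lemma isProbFamily_dyadLaw : IsProbFamily θ.dyadLaw :=
  ⟨fun _ _ => θ.dyadProb_nonneg _ _ _, fun _ => θ.sum_dyadProb _ _⟩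

lemma law_singleton (ω : Config n) :
    θ.law {ω} = ENNReal.ofReal (∏ d, θ.dyadLaw d (ω d)) := by
  rw [law, Measure.pi_singleton, ENNReal.ofReal_prod_of_nonneg
    fun d _ => θ.isProbFamily_dyadLaw.nonneg d _]
  refine Finset.prod_congr rfl fun d _ => ?_
  rw [PMF.toMeasure_apply_singleton _ _ (measurableSet_singleton _)]
  rfl

lemma mse_eq (T : Matrix (Fin n) (Fin n) ℝ → ℝ) :
    θ.mse T = ENNReal.ofReal (Ex θ.dyadLaw fun ω => (T (adjacency ω) - θ.ρ) ^ 2) := by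
  rw [mse, lintegral_fintype, Ex, ENNReal.ofReal_sum_of_nonneg
    fun ω _ => mul_nonneg (θ.isProbFamily_dyadLaw.weight_nonneg ω) (sq_nonneg _)]
  refine Finset.sum_congr rfl fun ω _ => ?_
  rw [law_singleton, mul_comm, ENNReal.ofReal_mul (θ.isProbFamily_dyadLaw.weight_nonneg ω)]

end P1Param

/-! ### Lower bound: the two point method. -/

section TwoPoint

variable {ι σ : Type*} [Fintype ι] [DecidableEq ι] [Fintype σ]

/-- The Hellinger affinity of two product laws is the product of the affinities. -/
lemma sum_sqrt_prod_mul_prod {p q : ι → σ → ℝ} (hp : IsProbFamily p) (hq : IsProbFamily q) :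
    ∑ ω : ι → σ, √((∏ d, p d (ω d)) * ∏ d, q d (ω d)) = ∏ d, ∑ s, √(p d s * q d s) := by
  rw [Finset.prod_univ_sum, Fintype.piFinset_univ]
  refine Finset.sum_congr rfl fun ω _ => ?_
  rw [← Finset.prod_mul_distrib, Real.sqrt_eq_rpow,
    ← Real.finsetProd_rpow _ _ fun d _ => mul_nonneg (hp.nonneg d _) (hq.nonneg d _)]
  simp only [Real.sqrt_eq_rpow]

/-- Le Cam's two point bound through the Hellinger affinity. -/
lemma sq_mul_affinity_sq_le {p q : ι → σ → ℝ} (hp : IsProbFamily p) (hq : IsProbFamily q)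
    (T : (ι → σ) → ℝ) (a b M : ℝ) (ha : Ex p (fun ω => (T ω - a) ^ 2) ≤ M)
    (hb : Ex q (fun ω => (T ω - b) ^ 2) ≤ M) :
    (a - b) ^ 2 * (∏ d, ∑ s, √(p d s * q d s)) ^ 2 ≤ 4 * M := by
  rw [← sum_sqrt_prod_mul_prod hp hq]
  set P : (ι → σ) → ℝ := fun ω => ∏ d, p d (ω d)
  set R : (ι → σ) → ℝ := fun ω => ∏ d, q d (ω d)
  have hP : ∀ ω, 0 ≤ P ω := hp.weight_nonneg
  have hR : ∀ ω, 0 ≤ R ω := hq.weight_nonneg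
  have hM : 0 ≤ M := (hp.Ex_nonneg fun ω => sq_nonneg _).trans ha
  -- Cauchy–Schwarz, with √P of unit norm in ℓ² and the error measured under R; `e2` exchanges the
  -- roles.
  have e1 : (∑ ω, √(P ω * R ω) * (T ω - b)) ^ 2 ≤ M := by
    calc (∑ ω, √(P ω * R ω) * (T ω - b)) ^ 2
        = (∑ ω, √(P ω) * (√(R ω) * (T ω - b))) ^ 2 := by
          congr 1; refine Finset.sum_congr rfl fun ω _ => ?_
          rw [Real.sqrt_mul (hP ω)]; ring
      _ ≤ (∑ ω, √(P ω) ^ 2) * ∑ ω, (√(R ω) * (T ω - b)) ^ 2 :=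
          Finset.sum_mul_sq_le_sq_mul_sq _ _ _
      _ = Ex q (fun ω => (T ω - b) ^ 2) := by
          simp only [mul_pow, Real.sq_sqrt (hP _), Real.sq_sqrt (hR _)]
          rw [hp.sum_weight, one_mul]; rfl
      _ ≤ M := hb
  have e2 : (∑ ω, √(P ω * R ω) * (T ω - a)) ^ 2 ≤ M := by
    calc (∑ ω, √(P ω * R ω) * (T ω - a)) ^ 2
        = (∑ ω, √(R ω) * (√(P ω) * (T ω - a))) ^ 2 := by
          congr 1; refine Finset.sum_congr rfl fun ω _ => ?_
          rw [Real.sqrt_mul (hP ω)]; ring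
      _ ≤ (∑ ω, √(R ω) ^ 2) * ∑ ω, (√(P ω) * (T ω - a)) ^ 2 :=
          Finset.sum_mul_sq_le_sq_mul_sq _ _ _
      _ = Ex p (fun ω => (T ω - a) ^ 2) := by
          simp only [mul_pow, Real.sq_sqrt (hP _), Real.sq_sqrt (hR _)]
          rw [hq.sum_weight, one_mul]; rfl
      _ ≤ M := ha
  -- The estimator cancels in a - b = (T - b) - (T - a). Both terms are at most √M in absolute
  -- value, whence 4M.
  have e3 : (a - b) * ∑ ω, √(P ω * R ω) =
      (∑ ω, √(P ω * R ω) * (T ω - b)) - ∑ ω, √(P ω * R ω) * (T ω - a) := by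
    rw [← Finset.sum_sub_distrib, Finset.mul_sum]
    exact Finset.sum_congr rfl fun ω _ => by ring
  rw [← mul_pow, e3]
  nlinarith [sq_nonneg ((∑ ω, √(P ω * R ω) * (T ω - b)) + ∑ ω, √(P ω * R ω) * (T ω - a))]

end TwoPoint

/-! ### Lower bound: homogeneous parameters. -/

namespace P1Param

/-- The homogeneous parameter with `μ_i = ν_i = m`. -/
def homogeneous (n : ℕ) (ρ m : ℝ) : P1Param n where
  ρ := ρ
  γ := 2 * Real.log m
  α := 0
  β := 0
  sum_α := by simp
  sum_β := by simp

variable {n : ℕ} {ρ m : ℝ}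

lemma homogeneous_mu (hm : 0 < m) (i : Fin n) : (homogeneous n ρ m).mu i = m := by
  simp [mu, homogeneous, Real.exp_log hm]

lemma homogeneous_nu (hm : 0 < m) (i : Fin n) : (homogeneous n ρ m).nu i = m := by
  simp [nu, homogeneous, Real.exp_log hm]

lemma homogeneous_dyadProb (hm : 0 < m) (i j : Fin n) (ab : Bool × Bool) :
    (homogeneous n ρ m).dyadProb i j ab =
      (1 + 2 * m ^ 2 + m ^ 4 * Real.exp ρ)⁻¹ *
        (if ab.1 then m ^ 2 else 1) * (if ab.2 then m ^ 2 else 1) *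
        (if ab.1 && ab.2 then Real.exp ρ else 1) := by
  have h2 : Real.exp (2 * Real.log m) = m ^ 2 := by
    rw [mul_comm, Real.exp_mul, Real.exp_log hm]; norm_num
  have h4 : Real.exp (2 * (2 * Real.log m)) = m ^ 4 := by
    rw [two_mul, Real.exp_add, h2]; ring
  obtain ⟨a, b⟩ := ab
  have hK : (homogeneous n ρ m).K i j = (1 + 2 * m ^ 2 + m ^ 4 * Real.exp ρ)⁻¹ := by
    simp [K, homogeneous, Real.exp_add, h2, h4]; ring
  rw [dyadProb, hK]
  cases a <;> cases b <;> (simp [homogeneous, Real.exp_add, h2]; try ring)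

/-- Affinity of two homogeneous dyad laws with `e^{ρ'} = e^ρ (1 + v)²`. -/
lemma exp_neg_le_homogeneous_affinity_sq {ρ' v : ℝ} (hm : 0 < m) (hv : 0 ≤ v)
    (hρ : Real.exp ρ' = Real.exp ρ * (1 + v) ^ 2) (i j : Fin n) :
    Real.exp (-(v ^ 2 * (m ^ 4 * Real.exp ρ))) ≤
      (∑ s, √((homogeneous n ρ m).dyadProb i j s * (homogeneous n ρ' m).dyadProb i j s)) ^ 2 := by
  set x := m ^ 4 * Real.exp ρ with hx
  set z := 1 + 2 * m ^ 2 + x with hz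
  have hx0 : 0 < x := by positivity
  have hz0 : 1 + x ≤ z := by rw [hz]; nlinarith [sq_nonneg m]
  set z' := 1 + 2 * m ^ 2 + m ^ 4 * Real.exp ρ' with hz'
  have hz'e : z' = z + (2 * v + v ^ 2) * x := by rw [hz', hρ, hz, hx]; ring
  have hz'0 : 0 < z' := by rw [hz'e]; positivity
  have hzpos : 0 < z := by linarith
  -- Up to the common normalization the four roots are x(1 + v), m², m² and 1, with sum z + vx.
  have key : ∑ s, √((homogeneous n ρ m).dyadProb i j s * (homogeneous n ρ' m).dyadProb i j s)
      = √(z⁻¹ * z'⁻¹) * (z + v * x) := by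
    simp only [homogeneous_dyadProb hm, Fintype.sum_prod_type, Fintype.sum_bool, hρ]
    rw [← hx, ← hz]
    have hz'' : 1 + 2 * m ^ 2 + m ^ 4 * (Real.exp ρ * (1 + v) ^ 2) = z' := by rw [hz', hρ]
    rw [hz'']
    have h1 : ∀ w : ℝ, 0 ≤ w → √(z⁻¹ * z'⁻¹ * w ^ 2) = √(z⁻¹ * z'⁻¹) * w := fun w hw => by
      rw [Real.sqrt_mul (by positivity), Real.sqrt_sq hw]
    have e1 := h1 (m ^ 4 * Real.exp ρ * (1 + v)) (by positivity)
    have e2 := h1 (m ^ 2) (by positivity)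
    have e3 := h1 1 (by positivity)
    have f1 : z⁻¹ * m ^ 2 * m ^ 2 * Real.exp ρ * (z'⁻¹ * m ^ 2 * m ^ 2 *
      (Real.exp ρ * (1 + v) ^ 2)) = z⁻¹ * z'⁻¹ * (m ^ 4 * Real.exp ρ * (1 + v)) ^ 2 := by ring
    have f2 : z⁻¹ * m ^ 2 * (z'⁻¹ * m ^ 2) = z⁻¹ * z'⁻¹ * (m ^ 2) ^ 2 := by ring
    have f3 : z⁻¹ * z'⁻¹ = z⁻¹ * z'⁻¹ * 1 ^ 2 := by ring
    simp only [if_true, Bool.false_eq_true, if_false, Bool.and_false, Bool.false_and,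
      Bool.and_self, mul_one]
    rw [f1, e1, f2, e2, hz, hx]
    ring
  rw [key, mul_pow, Real.sq_sqrt (by positivity)]
  have h1 : Real.exp (-(v ^ 2 * x)) ≤ (1 + v ^ 2 * x)⁻¹ := by
    rw [Real.exp_neg]
    exact inv_anti₀ (by positivity) (by linarith [Real.add_one_le_exp (v ^ 2 * x)])
  refine h1.trans ?_
  rw [← mul_inv, ← div_eq_inv_mul, inv_eq_one_div, div_le_div_iff₀ (by positivity) (by positivity),
    hz'e]
  -- The claim is now z z' ≤ (z + vx)²(1 + v²x). Since z z' = (z + vx)² + v²x(z - x), it is enough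
  -- that z ≤ (z + vx)², which follows from z ≥ 1.
  have h2 : v ^ 2 * x * z ≤ v ^ 2 * x * (z + v * x) ^ 2 :=
    mul_le_mul_of_nonneg_left (by nlinarith [mul_nonneg hv hx0.le]) (by positivity)
  nlinarith [sq_nonneg (v * x)]

lemma maxEntry_const (hn : 0 < n) (c : ℝ) : maxEntry (fun _ : Fin n => c) = c := by
  have : Nonempty (Fin n) := ⟨⟨0, hn⟩⟩
  simp [maxEntry]

/-- Membership of homogeneous parameters in `Θ(ε)`, at the largest allowed `μ_max`. -/
lemma homogeneous_mem_Theta {cL κ ε : ℝ} (hκ : 1 ≤ κ) (hn : 0 < n)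
    (hL : 1 ≤ Real.log (Real.log n)) (hn' : Real.log n ^ 2 * Real.log (Real.log n) ^ 3 ≤ n)
    (hm : m = 1 / Real.log (Real.log n))
    (hε : (Real.log (Real.log n) / n) ^ 2 ≤ ε)
    (hε' : ε ≤ 1 / (Real.log n * Real.log (Real.log n) ^ 2))
    (h1 : 1 ≤ ε * (Real.exp ρ * (n * m ^ 2) ^ 2))
    (h2 : Real.exp ρ * m ^ 4 * Real.log (Real.log n) ^ 2 ≤ 1) :
    homogeneous n ρ m ∈ Theta cL κ n ε := by
  set L := Real.log (Real.log n) with hLdef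
  have hn0 : (0 : ℝ) < n := by exact_mod_cast hn
  have hL0 : 0 < L := by linarith
  have hm0 : 0 < m := by rw [hm]; positivity
  have hlog : 0 < Real.log n := by
    by_contra h
    have h5 : Real.log n = 0 := le_antisymm (not_lt.1 h) (Real.log_natCast_nonneg n)
    rw [hLdef, h5] at hL; simp at hL; linarith
  have hε0 : 0 < ε := lt_of_lt_of_le (by positivity) hε
  have hmu : (homogeneous n ρ m).mu = fun _ => m := funext (homogeneous_mu hm0)
  have hnu : (homogeneous n ρ m).nu = fun _ => m := funext (homogeneous_nu hm0)
  have heta : (homogeneous n ρ m).eta = fun _ => m ^ 2 := funext fun i => by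
    rw [eta, homogeneous_mu hm0, homogeneous_nu hm0, sq]
  have hl1 : l1norm (fun _ : Fin n => m ^ 2) = n * m ^ 2 := by simp [l1norm]
  have hl1' : l1norm (fun _ : Fin n => m) = n * m := by simp [l1norm, abs_of_pos hm0]
  have hdot : (fun _ : Fin n => m) ⬝ᵥ (fun _ => m ^ 2) = n * m ^ 3 := by
    simp only [dotProduct, Finset.sum_const, Finset.card_univ, Fintype.card_fin, nsmul_eq_mul]; ring
  have hmL : m * L = 1 := by rw [hm]; field_simp
  have hhalf : Real.exp (ρ / 2) ^ 2 = Real.exp ρ := by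
    rw [← Real.exp_nat_mul]; congr 1; push_cast; ring
  refine ⟨⟨?_, ?_, ?_, ?_, ?_, ?_⟩, ?_, ?_⟩
  · rw [hmu, maxEntry_const hn, le_div_iff₀ hm0]; linarith
  · rw [hnu, maxEntry_const hn, le_div_iff₀ hm0]; linarith
  · rw [heta, maxEntry_const hn, le_div_iff₀ (by positivity)]
    refine abs_le_of_sq_le_sq' ?_ zero_le_one |>.2
    calc (L * (Real.exp ((homogeneous n ρ m).ρ / 2) * m ^ 2)) ^ 2
        = Real.exp (ρ / 2) ^ 2 * m ^ 4 * L ^ 2 := by simp only [homogeneous]; ring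
      _ ≤ 1 ^ 2 := by rw [hhalf]; linarith
  · rw [heta, hl1, le_div_iff₀ (by positivity)]
    have : Real.log n ^ 2 * L ^ 3 * m ^ 2 ≤ n * m ^ 2 :=
      mul_le_mul_of_nonneg_right hn' (by positivity)
    calc L * Real.log n ^ 2 = Real.log n ^ 2 * L * (m * L) ^ 2 := by rw [hmL]; ring
      _ = Real.log n ^ 2 * L ^ 3 * m ^ 2 := by ring
      _ ≤ _ := this
  · rw [heta, hl1, le_div_iff₀ (by positivity)]
    -- Squared, the condition is L² log n ≤ e^ρ ‖η‖₁². It holds because ε L² log n ≤ 1 ≤ ε e^ρ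
    -- ‖η‖₁², so it reflects the upper end of the range of ε.
    refine abs_le_of_sq_le_sq' ?_ (by positivity) |>.2
    have h3 : (L * √(Real.log n)) ^ 2 = L ^ 2 * Real.log n := by
      rw [mul_pow, Real.sq_sqrt hlog.le]
    have h4 : (Real.exp ((homogeneous n ρ m).ρ / 2) * (n * m ^ 2)) ^ 2
        = Real.exp ρ * (n * m ^ 2) ^ 2 := by
      simp only [homogeneous]; rw [mul_pow, hhalf]
    rw [h3, h4]
    have h5 : ε * (L ^ 2 * Real.log n) ≤ 1 := by
      rw [le_div_iff₀ (by positivity)] at hε'; linarith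
    exact le_of_mul_le_mul_left (h5.trans h1) hε0
  · rw [hmu, hnu, heta, hdot, maxEntry_const hn, le_div_iff₀ (by positivity)]
    have h6 : L ≤ (n * m) ^ 2 := by
      have h7 : L ≤ n * m := by
        have h9 : 1 ≤ Real.log n := by
          by_contra h
          have := Real.log_nonpos hlog.le (not_le.1 h).le
          linarith
        have h8 : L ^ 2 ≤ n := by
          refine le_trans ?_ hn'
          have := one_le_pow₀ (n := 2) h9
          nlinarith [pow_pos hL0 2, pow_pos hL0 3, mul_le_mul_of_nonneg_left hL (pow_pos hL0 2).le]
        calc L = L ^ 2 * m := by linear_combination -L * hmL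
          _ ≤ n * m := mul_le_mul_of_nonneg_right h8 hm0.le
      nlinarith
    calc L * (m ^ 2 * m ^ 2) ≤ (n * m) ^ 2 * (m ^ 2 * m ^ 2) :=
          mul_le_mul_of_nonneg_right h6 (by positivity)
      _ = _ := by ring
  · rw [rate, hmu, hnu, heta, hdot, hl1]
    refine max_le ?_ ?_
    · rw [div_le_iff₀ (by positivity)]; exact h1
    · refine le_trans (le_of_eq ?_) hε
      rw [hm]; field_simp
  · intro _
    rw [hmu, hnu, hl1']
    have : 0 ≤ n * m := by positivity
    exact ⟨div_le_self this hκ, le_mul_of_one_le_left this hκ⟩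

end P1Param

/-! ### Lower bound: choice of the two points and asymptotics. -/

lemma half_le_log_one_add {v : ℝ} (hv0 : 0 ≤ v) (hv1 : v ≤ 1) : v / 2 ≤ Real.log (1 + v) := by
  refine le_trans ?_ (Real.one_sub_inv_le_log_of_pos (show 0 < 1 + v by linarith))
  have h : 1 - (1 + v)⁻¹ = v / (1 + v) := by field_simp; ring
  rw [h]
  exact div_le_div_of_nonneg_left hv0 (by linarith) (by linarith)

/-- The dyads and their reversals embed disjointly into the ordered pairs. -/
lemma card_dyad_le (n : ℕ) : (Fintype.card (Dyad n) : ℝ) ≤ n ^ 2 / 2 := by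
  have hsum : Fintype.card (Dyad n ⊕ Dyad n) ≤ Fintype.card (Fin n × Fin n) := by
    refine Fintype.card_le_of_injective (Sum.elim (fun d => d.1) (fun d => d.1.swap)) ?_
    rintro (⟨⟨a, b⟩, h⟩ | ⟨⟨a, b⟩, h⟩) (⟨⟨c, d⟩, h'⟩ | ⟨⟨c, d⟩, h'⟩) he <;>
      simp only [Sum.elim_inl, Sum.elim_inr, Prod.swap_prod_mk, Prod.mk.injEq] at he <;>
      obtain ⟨rfl, rfl⟩ := he
    · rfl
    · exact absurd h (not_lt.2 h'.le)
    · exact absurd h (not_lt.2 h'.le)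
    · rfl
  simp only [Fintype.card_sum, Fintype.card_prod, Fintype.card_fin] at hsum
  have : ((Fintype.card (Dyad n) + Fintype.card (Dyad n) : ℕ) : ℝ) ≤ (n * n : ℕ) := by
    exact_mod_cast hsum
  push_cast at this
  linarith

/-- The two point lower bound, with everything that has to hold for large `n` as a hypothesis. -/
lemma minimaxRisk_lower {cL κ ε δ : ℝ} {n : ℕ} (hκ : 1 ≤ κ) (hn : 0 < n)
    (hL : 1 ≤ Real.log (Real.log n)) (hn' : Real.log n ^ 2 * Real.log (Real.log n) ^ 3 ≤ n)
    (hδ : 0 < δ)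
    (hε : (1 + δ) * (Real.log (Real.log n) / n) ^ 2 ≤ ε)
    (hε' : ε ≤ 1 / (Real.log n * Real.log (Real.log n) ^ 2))
    (hε1 : ε ≤ 1) (hsm : (1 + √ε) ^ 2 ≤ 1 + δ) :
    ENNReal.ofReal (Real.exp (-1) / 4 * ε) ≤ minimaxRisk cL κ n ε := by
  set L := Real.log (Real.log n) with hLdef
  have hn0 : (0 : ℝ) < n := by exact_mod_cast hn
  have hL0 : 0 < L := by linarith
  have hε2 : (L / n) ^ 2 ≤ ε := by nlinarith [sq_nonneg (L / n)]
  have hε0 : 0 < ε := lt_of_lt_of_le (by positivity) hε2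
  set m := 1 / L with hm
  have hm0 : 0 < m := by positivity
  set v := √ε with hv
  have hv0 : 0 < v := Real.sqrt_pos.2 hε0
  have hv2 : v ^ 2 = ε := Real.sq_sqrt hε0.le
  -- The smallest ρ allowed by the rate condition: 1/(e^ρ ‖η‖₁²) is exactly ε. The second point must
  -- then lie above it.
  set ρ := Real.log (1 / (ε * (n * m ^ 2) ^ 2)) with hρ
  set ρ' := ρ + 2 * Real.log (1 + v) with hρ'
  have eρ : Real.exp ρ = 1 / (ε * (n * m ^ 2) ^ 2) := Real.exp_log (by positivity)
  have eρ' : Real.exp ρ' = Real.exp ρ * (1 + v) ^ 2 := by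
    have h : Real.exp (2 * Real.log (1 + v)) = (1 + v) ^ 2 := by
      rw [two_mul, Real.exp_add, Real.exp_log (show 0 < 1 + v by positivity), sq]
    rw [hρ', Real.exp_add, h]
  have h1 : ε * (Real.exp ρ * (n * m ^ 2) ^ 2) = 1 := by rw [eρ]; field_simp
  have hx : n ^ 2 * (m ^ 4 * Real.exp ρ) * ε = 1 := by rw [← h1]; ring
  have hmL : m * L = 1 := by rw [hm]; field_simp
  -- The bound on e^{ρ'/2} η_max, squared. The margin 1 + δ pays for the factor (1 + v)² here.
  have h2' : Real.exp ρ' * m ^ 4 * L ^ 2 ≤ 1 := by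
    rw [eρ']
    calc Real.exp ρ * (1 + v) ^ 2 * m ^ 4 * L ^ 2 ≤ Real.exp ρ * (1 + δ) * m ^ 4 * L ^ 2 := by
          gcongr
      _ = (n ^ 2 * (m ^ 4 * Real.exp ρ)) * ((1 + δ) * (L / n) ^ 2) := by field_simp
      _ ≤ (n ^ 2 * (m ^ 4 * Real.exp ρ)) * ε := by gcongr
      _ = 1 := hx
  have hle : Real.exp ρ ≤ Real.exp ρ' := by
    rw [eρ']
    exact le_mul_of_one_le_right (Real.exp_pos _).le (one_le_pow₀ (by linarith))
  have h2 : Real.exp ρ * m ^ 4 * L ^ 2 ≤ 1 := by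
    refine le_trans ?_ h2'; gcongr
  have h1' : 1 ≤ ε * (Real.exp ρ' * (n * m ^ 2) ^ 2) := by
    rw [← h1]; gcongr
  have mem := P1Param.homogeneous_mem_Theta (cL := cL) hκ hn hL hn' hm hε2 hε' h1.ge h2
  have mem' := P1Param.homogeneous_mem_Theta (cL := cL) hκ hn hL hn' hm hε2 hε' h1' h2'
  refine le_iInf fun T => ?_
  set θ := P1Param.homogeneous n ρ m
  set θ' := P1Param.homogeneous n ρ' m
  set a := Ex θ.dyadLaw fun ω => (T (adjacency ω) - θ.ρ) ^ 2 with ha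
  set b := Ex θ'.dyadLaw fun ω => (T (adjacency ω) - θ'.ρ) ^ 2 with hb
  have hsup : ENNReal.ofReal (max a b) ≤ worstRisk cL κ n ε T := by
    rcases le_total a b with h | h
    · rw [max_eq_right h, hb, ← P1Param.mse_eq]
      exact le_iSup₂_of_le θ' mem' le_rfl
    · rw [max_eq_left h, ha, ← P1Param.mse_eq]
      exact le_iSup₂_of_le θ mem le_rfl
  refine le_trans (ENNReal.ofReal_le_ofReal ?_) hsup
  have hLC := sq_mul_affinity_sq_le θ.isProbFamily_dyadLaw θ'.isProbFamily_dyadLaw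
    (fun ω => T (adjacency ω)) θ.ρ θ'.ρ (max a b) (le_max_left _ _) (le_max_right _ _)
  -- Each dyad contributes the exponent ε m⁴ e^ρ = 1/n², and there are at most n²/2 dyads.
  have haff : Real.exp (-(1 / 2)) ≤
      (∏ d, ∑ s, √(θ.dyadLaw d s * θ'.dyadLaw d s)) ^ 2 := by
    rw [← Finset.prod_pow]
    have hcard := card_dyad_le n
    calc Real.exp (-(1 / 2))
        ≤ Real.exp (-(v ^ 2 * (m ^ 4 * Real.exp ρ))) ^ Fintype.card (Dyad n) := by
          rw [← Real.exp_nat_mul]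
          refine Real.exp_le_exp.2 ?_
          rw [hv2]
          have h6 : 0 ≤ ε * (m ^ 4 * Real.exp ρ) := by positivity
          nlinarith [mul_le_mul_of_nonneg_right hcard h6]
      _ = ∏ _d : Dyad n, Real.exp (-(v ^ 2 * (m ^ 4 * Real.exp ρ))) := by simp
      _ ≤ _ := Finset.prod_le_prod (fun _ _ => (Real.exp_pos _).le) fun d _ =>
          P1Param.exp_neg_le_homogeneous_affinity_sq hm0 hv0.le eρ' _ _
  -- The squared distance is already at least ε; the extra factor is given away to make the final
  -- constant e⁻¹/4.
  have hdiff : ε * Real.exp (-(1 / 2)) ≤ (θ.ρ - θ'.ρ) ^ 2 := by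
    have h7 : θ.ρ - θ'.ρ = -(2 * Real.log (1 + v)) := by
      simp [θ, θ', P1Param.homogeneous, hρ']
    have hv1 : v ≤ 1 := Real.sqrt_le_one.2 hε1
    have h8 := half_le_log_one_add hv0.le hv1
    rw [h7, ← hv2]
    have : Real.exp (-(1 / 2)) ≤ 1 := Real.exp_le_one_iff.2 (by norm_num)
    calc v ^ 2 * Real.exp (-(1 / 2)) ≤ v ^ 2 := mul_le_of_le_one_right (sq_nonneg v) this
      _ = (2 * (v / 2)) ^ 2 := by ring
      _ ≤ (2 * Real.log (1 + v)) ^ 2 := by gcongr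
      _ = _ := by ring
  have hprod : ε * Real.exp (-(1 / 2)) * Real.exp (-(1 / 2)) ≤ 4 * max a b :=
    le_trans (mul_le_mul hdiff haff (Real.exp_pos _).le (sq_nonneg _)) hLC
  have he : Real.exp (-(1 / 2)) * Real.exp (-(1 / 2)) = Real.exp (-1) := by
    rw [← Real.exp_add]; norm_num
  rw [mul_assoc, he] at hprod
  linarith

lemma eventually_one_le_log_log :
    ∀ M : ℝ, ∀ᶠ n : ℕ in atTop, M ≤ Real.log (Real.log n) := fun M =>
  ((Real.tendsto_log_atTop.comp Real.tendsto_log_atTop).comp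
    tendsto_natCast_atTop_atTop).eventually_ge_atTop M

lemma eventually_log_sq_mul_le :
    ∀ᶠ n : ℕ in atTop, Real.log n ^ 2 * Real.log (Real.log n) ^ 3 ≤ n := by
  have h : ∀ᶠ x : ℝ in atTop, x ^ 5 ≤ Real.exp x := by
    have h := (Real.tendsto_exp_div_pow_atTop 5).eventually_ge_atTop 1
    filter_upwards [h, eventually_gt_atTop 0] with x hx hx0
    rwa [le_div_iff₀ (by positivity), one_mul] at hx
  have h' := (Real.tendsto_log_atTop.comp tendsto_natCast_atTop_atTop).eventually h
  filter_upwards [h', eventually_one_le_log_log 1, eventually_gt_atTop 0] with n hn hL hn0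
  simp only [Function.comp] at hn
  rw [Real.exp_log (by exact_mod_cast hn0)] at hn
  have h1 : 0 ≤ Real.log n := Real.log_natCast_nonneg n
  have h0 : 0 < Real.log n := by
    by_contra h
    have h5 : Real.log n = 0 := le_antisymm (not_lt.1 h) h1
    rw [h5] at hL; simp at hL; linarith
  refine le_trans ?_ hn
  calc Real.log n ^ 2 * Real.log (Real.log n) ^ 3 ≤ Real.log n ^ 2 * Real.log n ^ 3 := by
        gcongr; exact Real.log_le_self (Nat.cast_nonneg n)
    _ = _ := by ring

lemma minimaxRisk_lower_eventually (cL κ : ℝ) (hκ : 1 ≤ κ) (δ : ℝ) (hδ : 0 < δ) :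
    ∀ᶠ n : ℕ in atTop, ∀ ε : ℝ,
        (1 + δ) * (Real.log (Real.log n) / n) ^ 2 ≤ ε →
        ε ≤ 1 / (Real.log n * Real.log (Real.log n) ^ 2) →
          ENNReal.ofReal (Real.exp (-1) / 4 * ε) ≤ minimaxRisk cL κ n ε := by
  -- If √ε ≤ t ≤ 1, then (1 + √ε)² ≤ 1 + 3t ≤ 1 + δ.
  set t := min 1 (δ / 3) with ht
  have ht0 : 0 < t := by positivity
  filter_upwards [eventually_one_le_log_log 1, eventually_one_le_log_log (1 / t),
    eventually_log_sq_mul_le, eventually_gt_atTop 0] with n hL hL2 hn' hn ε hε hε'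
  have hlog : 1 ≤ Real.log n := by
    by_contra h
    have := Real.log_nonpos (Real.log_natCast_nonneg n) (not_le.1 h).le
    linarith
  have hεt : ε ≤ t ^ 2 := by
    refine hε'.trans ?_
    rw [div_le_iff₀ (by positivity)]
    have h3 : 1 ≤ t * Real.log (Real.log n) := by
      rwa [div_le_iff₀ ht0, mul_comm] at hL2
    have h4 : 1 ≤ (t * Real.log (Real.log n)) ^ 2 := one_le_pow₀ h3
    nlinarith
  have hst : √ε ≤ t := Real.sqrt_le_iff.2 ⟨ht0.le, hεt⟩
  have h1 : t ≤ 1 := min_le_left _ _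
  have h2 : t ≤ δ / 3 := min_le_right _ _
  refine minimaxRisk_lower hκ hn hL hn' hδ hε hε' (hεt.trans (pow_le_one₀ ht0.le h1)) ?_
  nlinarith [Real.sqrt_nonneg ε]

/-! ### Independence of several factors, Jensen and Fubini. -/

section ProductExpectation

variable {ι σ : Type*} [Fintype ι] [DecidableEq ι] [Fintype σ]

omit [Fintype ι] [DecidableEq ι] [Fintype σ] in
lemma dependsOn_finset_prod {κ : Type*} (s : Finset κ) {D : κ → Set ι}
    {g : κ → (ι → σ) → ℝ} (hg : ∀ k, DependsOn (g k) (D k)) :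
    DependsOn (fun ω => ∏ k ∈ s, g k ω) (⋃ k ∈ s, D k) := fun _ _ h =>
  Finset.prod_congr rfl fun k hk => hg k fun i hi => h i (Set.mem_biUnion hk hi)

lemma IsProbFamily.Ex_prod_of_dependsOn [Inhabited σ] {p : ι → σ → ℝ} (hp : IsProbFamily p)
    {κ : Type*} (s : Finset κ) {D : κ → Set ι}
    (hD : ∀ k l, k ≠ l → Disjoint (D k) (D l)) {g : κ → (ι → σ) → ℝ}
    (hg : ∀ k, DependsOn (g k) (D k)) :
    Ex p (fun ω => ∏ k ∈ s, g k ω) = ∏ k ∈ s, Ex p (g k) := by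
  classical
  induction s using Finset.induction_on with
  | empty => simp [hp.Ex_const]
  | insert a s ha ih =>
    simp only [Finset.prod_insert ha]
    rw [hp.Ex_mul_of_dependsOn (D := D a) (D' := ⋃ k ∈ s, D k) _ (hg a)
      (dependsOn_finset_prod s hg), ih]
    exact Set.disjoint_iUnion₂_right.2 fun k hk => hD a k fun h => ha (h ▸ hk)

lemma IsProbFamily.sq_Ex_le {p : ι → σ → ℝ} (hp : IsProbFamily p) (F : (ι → σ) → ℝ) :
    Ex p F ^ 2 ≤ Ex p (fun ω => F ω ^ 2) := by
  have := hp.Ex_nonneg (fun ω => sq_nonneg (F ω - Ex p F))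
  rw [hp.Ex_variance] at this
  linarith

lemma Ex_comm {ι' σ' : Type*} [Fintype ι'] [DecidableEq ι'] [Fintype σ'] (p : ι → σ → ℝ)
    (q : ι' → σ' → ℝ) (F : (ι → σ) → (ι' → σ') → ℝ) :
    Ex p (fun ω => Ex q (F ω)) = Ex q (fun χ => Ex p (fun ω => F ω χ)) := by
  simp only [Ex, Finset.mul_sum]
  rw [Finset.sum_comm]
  exact Finset.sum_congr rfl fun _ _ => Finset.sum_congr rfl fun _ _ => by ring

end ProductExpectation

/-! ### The two statistics as counts of four-cycles. -/

variable {n : ℕ}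

/-- The pair `(A_{ij}, A_{ji})` of a configuration, for `i` and `j` in any order. -/
def dyadState (ω : Config n) (i j : Fin n) : Bool × Bool :=
  if h : i < j then ω ⟨(i, j), h⟩ else if h : j < i then (ω ⟨(j, i), h⟩).swap else (false, false)

lemma adjacency_eq_fst (ω : Config n) (i j : Fin n) :
    adjacency ω i j = ((dyadState ω i j).1.toNat : ℝ) := by
  unfold adjacency dyadState
  split_ifs <;> simp

lemma adjacency_eq_snd (ω : Config n) (i j : Fin n) :
    adjacency ω j i = ((dyadState ω i j).2.toNat : ℝ) := by
  unfold adjacency dyadState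
  rcases lt_trichotomy i j with h | h | h
  · simp [h, not_lt.2 h.le]
  · simp [h]
  · simp [h, not_lt.2 h.le]

/-- The indicator that the dyad of `i` and `j` is in state `s`. -/
def stateInd (s : Bool × Bool) (ω : Config n) (i j : Fin n) : ℝ :=
  if dyadState ω i j = s then 1 else 0

lemma stateInd_nonneg (s : Bool × Bool) (ω : Config n) (i j : Fin n) : 0 ≤ stateInd s ω i j := by
  unfold stateInd; split_ifs <;> norm_num

lemma stateInd_mul_self (s : Bool × Bool) (ω : Config n) (i j : Fin n) :
    stateInd s ω i j * stateInd s ω i j = stateInd s ω i j := by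
  unfold stateInd; split_ifs <;> norm_num

/-- Unordered pairs make the set of coordinates independent of the orientation in which the dyad is
stored. -/
lemma dependsOn_stateInd (s : Bool × Bool) (i j : Fin n) :
    DependsOn (fun ω : Config n => stateInd s ω i j) {d | s(d.1.1, d.1.2) = s(i, j)} := by
  intro x y h
  have : dyadState x i j = dyadState y i j := by
    unfold dyadState
    split_ifs with h1 h2
    · exact h _ rfl
    · exact congrArg Prod.swap (h ⟨(j, i), h2⟩ Sym2.eq_swap)
    · rfl
  simp only [stateInd, this]

lemma P1Param.dyadProb_swap (θ : P1Param n) (i j : Fin n) (s : Bool × Bool) :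
    θ.dyadProb j i s.swap = θ.dyadProb i j s := by
  have hK : θ.K j i = θ.K i j := by
    unfold K
    rw [add_right_comm 1]
    congr 4
    ring
  unfold dyadProb
  rw [hK]
  congr 2
  simp only [Prod.fst_swap, Prod.snd_swap]
  ring

lemma P1Param.Ex_stateInd (θ : P1Param n) {i j : Fin n} (hij : i ≠ j) (s : Bool × Bool) :
    Ex θ.dyadLaw (fun ω => stateInd s ω i j) = θ.dyadProb i j s := by
  have hp := θ.isProbFamily_dyadLaw
  rcases lt_or_gt_of_ne hij with h | h
  · have := hp.Ex_coord ⟨(i, j), h⟩ (fun t => if t = s then 1 else 0)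
    simpa [stateInd, dyadState, h, dyadLaw] using this
  · have := hp.Ex_coord ⟨(j, i), h⟩ (fun t => if t = s.swap then 1 else 0)
    rw [← θ.dyadProb_swap]
    simp only [stateInd, dyadState, h, not_lt.2 h.le, dif_pos, dif_neg, not_false_eq_true]
    simp only [← Prod.swap_inj (p := _) (q := s), Prod.swap_swap]
    simpa [dyadLaw] using this

/-- The four-cycle `S 0, S 1, S 2, S 3` has its dyads in the states `s`. -/
def cycleInd (s : Fin 4 → Bool × Bool) (ω : Config n) (S : Fin 4 → Fin n) : ℝ :=
  ∏ r, stateInd (s r) ω (S r) (S (r + 1))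

lemma cycleInd_nonneg (s : Fin 4 → Bool × Bool) (ω : Config n) (S : Fin 4 → Fin n) :
    0 ≤ cycleInd s ω S := Finset.prod_nonneg fun _ _ => stateInd_nonneg _ _ _ _

open Classical in
/-- The number of four-cycles with dyads in the states `s`. -/
def cycleCount (s : Fin 4 → Bool × Bool) (ω : Config n) : ℝ :=
  ∑ S : Fin 4 → Fin n, if Function.Injective S then cycleInd s ω S else 0

/-- The dyad states of `Q_n(a)`. -/
def patternA : Fin 4 → Bool × Bool := ![(true, true), (false, false), (false, true), (false, false)]

/-- The dyad states of `Q_n(b)`. -/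
def patternB : Fin 4 → Bool × Bool := ![(true, false), (true, false), (false, false), (true, false)]

/-- Quadruples as functions on `Fin 4`. -/
def quadEquiv (α : Type*) : (Fin 4 → α) ≃ α × α × α × α where
  toFun S := (S 0, S 1, S 2, S 3)
  invFun p := ![p.1, p.2.1, p.2.2.1, p.2.2.2]
  left_inv S := by ext r; fin_cases r <;> rfl
  right_inv p := rfl

lemma sum_quad {α : Type*} [Fintype α] [DecidableEq α] (F : (Fin 4 → α) → ℝ) :
    ∑ S, F S = ∑ i, ∑ j, ∑ k, ∑ l, F ![i, j, k, l] := by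
  rw [← (quadEquiv α).symm.sum_comp]
  simp only [Fintype.sum_prod_type]
  rfl

lemma injective_quad_iff (i j k l : Fin n) :
    Function.Injective ![i, j, k, l] ↔ Dist4 i j k l := by
  constructor
  · intro h
    refine ⟨fun e => ?_, fun e => ?_, fun e => ?_, fun e => ?_, fun e => ?_, fun e => ?_⟩
    · exact absurd (@h 0 1 e) (by decide)
    · exact absurd (@h 0 2 e) (by decide)
    · exact absurd (@h 0 3 e) (by decide)
    · exact absurd (@h 1 2 e) (by decide)
    · exact absurd (@h 1 3 e) (by decide)
    · exact absurd (@h 2 3 e) (by decide)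
  · rintro ⟨h1, h2, h3, h4, h5, h6⟩ r t e
    fin_cases r <;> fin_cases t <;> simp_all

lemma A11_adjacency (ω : Config n) (i j : Fin n) :
    A11 (adjacency ω) i j = stateInd (true, true) ω i j := by
  simp only [A11, Matrix.hadamard_apply, Matrix.transpose_apply, adjacency_eq_fst ω i j,
    adjacency_eq_snd ω i j, stateInd]
  generalize dyadState ω i j = t
  obtain ⟨_ | _, _ | _⟩ := t <;> simp

/-- The diagonal must be excluded: there the matrix entry is 0, while the default state is (false,
false). -/
lemma A00_adjacency (ω : Config n) {i j : Fin n} (h : i ≠ j) :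
    A00 (adjacency ω) i j = stateInd (false, false) ω i j := by
  simp only [A00, Jtilde, Matrix.hadamard_apply, Matrix.sub_apply, Matrix.of_apply,
    Matrix.one_apply_ne h, Matrix.transpose_apply, adjacency_eq_fst ω i j,
    adjacency_eq_snd ω i j, stateInd]
  generalize dyadState ω i j = t
  obtain ⟨_ | _, _ | _⟩ := t <;> simp

lemma A10_adjacency (ω : Config n) {i j : Fin n} (h : i ≠ j) :
    A10 (adjacency ω) i j = stateInd (true, false) ω i j := by
  simp only [A10, Jtilde, Matrix.hadamard_apply, Matrix.sub_apply, Matrix.of_apply,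
    Matrix.one_apply_ne h, Matrix.transpose_apply, adjacency_eq_fst ω i j,
    adjacency_eq_snd ω i j, stateInd]
  generalize dyadState ω i j = t
  obtain ⟨_ | _, _ | _⟩ := t <;> simp

lemma A01_adjacency (ω : Config n) {i j : Fin n} (h : i ≠ j) :
    A01 (adjacency ω) i j = stateInd (false, true) ω i j := by
  simp only [A01, A10, Jtilde, Matrix.hadamard_apply, Matrix.sub_apply, Matrix.of_apply,
    Matrix.one_apply_ne h.symm, Matrix.transpose_apply, adjacency_eq_fst ω i j,
    adjacency_eq_snd ω i j, stateInd]
  generalize dyadState ω i j = t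
  obtain ⟨_ | _, _ | _⟩ := t <;> simp

lemma Qa_adjacency (ω : Config n) : Qa (adjacency ω) = cycleCount patternA ω := by
  rw [Qa, cycleCount, sum_quad]
  refine Finset.sum_congr rfl fun i _ => Finset.sum_congr rfl fun j _ =>
    Finset.sum_congr rfl fun k _ => Finset.sum_congr rfl fun l _ => ?_
  simp only [injective_quad_iff]
  split_ifs with h
  · obtain ⟨h1, h2, h3, h4, h5, h6⟩ := h
    rw [A11_adjacency, A00_adjacency ω h4, A01_adjacency ω h6, A00_adjacency ω h3.symm,
      cycleInd, Fin.prod_univ_four]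
    rfl
  · rfl

lemma Qb_adjacency (ω : Config n) : Qb (adjacency ω) = cycleCount patternB ω := by
  rw [Qb, cycleCount, sum_quad]
  refine Finset.sum_congr rfl fun i _ => Finset.sum_congr rfl fun j _ =>
    Finset.sum_congr rfl fun k _ => Finset.sum_congr rfl fun l _ => ?_
  simp only [injective_quad_iff]
  split_ifs with h
  · obtain ⟨h1, h2, h3, h4, h5, h6⟩ := h
    rw [A10_adjacency ω h1, A10_adjacency ω h4, A00_adjacency ω h6, A10_adjacency ω h3.symm,
      cycleInd, Fin.prod_univ_four]
    rfl
  · rfl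

/-- Transported along an injective `S` (or an injective choice of colours), this makes the four
dyads of a cycle distinct and hence independent. -/
lemma succ_edge_injective :
    ∀ r t : Fin 4, s(r, r + 1) = s(t, t + 1) → r = t := by decide

lemma ne_add_one_fin_four : ∀ r : Fin 4, r ≠ r + 1 := by decide

/-- The mean of the indicator of a four-cycle. -/
lemma P1Param.Ex_cycleInd (θ : P1Param n) (s : Fin 4 → Bool × Bool) {S : Fin 4 → Fin n}
    (hS : Function.Injective S) :
    Ex θ.dyadLaw (fun ω => cycleInd s ω S) = ∏ r, θ.dyadProb (S r) (S (r + 1)) (s r) := by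
  unfold cycleInd
  rw [θ.isProbFamily_dyadLaw.Ex_prod_of_dependsOn Finset.univ
    (D := fun r => {d | s(d.1.1, d.1.2) = s(S r, S (r + 1))}) _
    fun r => dependsOn_stateInd (s r) (S r) (S (r + 1))]
  · refine Finset.prod_congr rfl fun r _ => θ.Ex_stateInd (fun h => ne_add_one_fin_four r (hS h)) _
  · intro r t hrt
    rw [Set.disjoint_left]
    intro d h1 h2
    have h3 : Sym2.map S s(r, r + 1) = Sym2.map S s(t, t + 1) := by
      simp only [Sym2.map_mk]
      exact h1.symm.trans h2
    exact hrt (succ_edge_injective r t (Sym2.map.injective hS h3))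

/-! ### Coloured counts and their variance. -/

section Coloured

variable {C : Type*} [DecidableEq C] (χ : Fin n → C) (c : Fin 4 → C)

/-- `S r` has the colour `c r`, for every `r`. -/
abbrev IsColoured (S : Fin 4 → Fin n) : Prop := ∀ r, χ (S r) = c r

/-- The number of four-cycles with dyads in the states `s` and vertices of the colours `c`. -/
def colouredCount (s : Fin 4 → Bool × Bool) (ω : Config n) : ℝ :=
  ∑ S : Fin 4 → Fin n, if IsColoured χ c S then cycleInd s ω S else 0

variable {χ c}

omit [DecidableEq C] in
lemma IsColoured.injective (hc : Function.Injective c) {S : Fin 4 → Fin n}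
    (hS : IsColoured χ c S) : Function.Injective S := fun r t h =>
  hc (by rw [← hS r, ← hS t, h])

/-- Distinct colours force distinct vertices, so every term of the coloured count occurs in the full
one. -/
lemma colouredCount_le (hc : Function.Injective c) (s : Fin 4 → Bool × Bool) (ω : Config n) :
    colouredCount χ c s ω ≤ cycleCount s ω := by
  refine Finset.sum_le_sum fun S _ => ?_
  split_ifs with h1 h2 h2
  · exact le_rfl
  · exact absurd (h1.injective hc) h2
  · exact cycleInd_nonneg _ _ _
  · exact le_rfl

/-- Used to show that counts with disjoint sets of colours are independent. -/
lemma dependsOn_colouredCount (s : Fin 4 → Bool × Bool) :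
    DependsOn (colouredCount χ c s)
      {d | χ d.1.1 ∈ Set.range c ∧ χ d.1.2 ∈ Set.range c} := by
  intro x y h
  refine Finset.sum_congr rfl fun S _ => ?_
  split_ifs with hS
  · refine Finset.prod_congr rfl fun r _ => dependsOn_stateInd (s r) (S r) (S (r + 1)) ?_
    intro d hd
    refine h d ?_
    rcases Sym2.eq_iff.1 hd with ⟨h1, h2⟩ | ⟨h1, h2⟩ <;> rw [Set.mem_ofPred_eq, h1, h2, hS, hS] <;>
      exact ⟨⟨_, rfl⟩, ⟨_, rfl⟩⟩
  · rfl

lemma P1Param.Ex_colouredCount (θ : P1Param n) (hc : Function.Injective c)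
    (s : Fin 4 → Bool × Bool) :
    Ex θ.dyadLaw (colouredCount χ c s) =
      ∑ S : Fin 4 → Fin n, if IsColoured χ c S then
        ∏ r, θ.dyadProb (S r) (S (r + 1)) (s r) else 0 := by
  unfold colouredCount
  rw [Ex_sum]
  refine Finset.sum_congr rfl fun S _ => ?_
  split_ifs with h
  · exact θ.Ex_cycleInd s (h.injective hc)
  · exact θ.isProbFamily_dyadLaw.Ex_const 0

/-- `1` if `S` and `S'` have the same dyad in position `r`. -/
def sameDyad (S S' : Fin 4 → Fin n) (r : Fin 4) : ℝ :=
  (if S r = S' r then 1 else 0) * (if S (r + 1) = S' (r + 1) then 1 else 0)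

-- Dyads in different positions have different pairs of colours, so they are distinct even when one
-- belongs to `S` and the other to `S'`; the expectation therefore factorises over the positions.
-- Within one position the two dyads are either independent, giving the product of probabilities, or
-- equal, where the idempotent indicator gives a single probability. The sum of the two expressions
-- covers both cases.
omit [DecidableEq C] in
lemma P1Param.Ex_cycleInd_mul_le (θ : P1Param n) (hc : Function.Injective c)
    (s : Fin 4 → Bool × Bool) {S S' : Fin 4 → Fin n} (hS : IsColoured χ c S)
    (hS' : IsColoured χ c S') :
    Ex θ.dyadLaw (fun ω => cycleInd s ω S * cycleInd s ω S') ≤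
      ∏ r, (θ.dyadProb (S r) (S (r + 1)) (s r) * θ.dyadProb (S' r) (S' (r + 1)) (s r)
        + sameDyad S S' r * θ.dyadProb (S r) (S (r + 1)) (s r)) := by
  have hp := θ.isProbFamily_dyadLaw
  have hsucc := ne_add_one_fin_four
  simp only [cycleInd, ← Finset.prod_mul_distrib]
  rw [hp.Ex_prod_of_dependsOn Finset.univ
    (D := fun r => {d | Sym2.map χ s(d.1.1, d.1.2) = s(c r, c (r + 1))})
    (g := fun r ω => stateInd (s r) ω (S r) (S (r + 1)) * stateInd (s r) ω (S' r) (S' (r + 1)))]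
  · refine Finset.prod_le_prod (fun r _ => hp.Ex_nonneg fun ω =>
      mul_nonneg (stateInd_nonneg _ _ _ _) (stateInd_nonneg _ _ _ _)) fun r _ => ?_
    have hne : S r ≠ S (r + 1) := fun h => hsucc r (hS.injective hc h)
    have hne' : S' r ≠ S' (r + 1) := fun h => hsucc r (hS'.injective hc h)
    by_cases h : S r = S' r ∧ S (r + 1) = S' (r + 1)
    · rw [sameDyad, if_pos h.1, if_pos h.2, ← h.1, ← h.2]
      simp only [stateInd_mul_self]
      rw [θ.Ex_stateInd hne]
      nlinarith [mul_nonneg (θ.dyadProb_nonneg (S r) (S (r + 1)) (s r))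
        (θ.dyadProb_nonneg (S r) (S (r + 1)) (s r))]
    · have h0 : sameDyad S S' r = 0 := by
        unfold sameDyad
        by_cases h1 : S r = S' r
        · have h2 : S (r + 1) ≠ S' (r + 1) := fun h2 => h ⟨h1, h2⟩
          simp [h2]
        · simp [h1]
      rw [h0, zero_mul, add_zero, hp.Ex_mul_of_dependsOn _ (dependsOn_stateInd _ _ _)
        (dependsOn_stateInd _ _ _), θ.Ex_stateInd hne, θ.Ex_stateInd hne']
      rw [Set.disjoint_left]
      intro d h1 h2
      rcases Sym2.eq_iff.1 (h1.symm.trans h2) with h3 | ⟨h3, -⟩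
      · exact h h3
      -- The same dyad traversed in opposite directions would give two successive corners the same
      -- colour.
      · have : c r = c (r + 1) := by rw [← hS r, h3, hS' (r + 1)]
        exact hsucc r (hc this)
  · intro r t hrt
    rw [Set.disjoint_left]
    intro d h1 h2
    have h3 : Sym2.map c s(r, r + 1) = Sym2.map c s(t, t + 1) := by
      simp only [Sym2.map_mk]
      exact h1.symm.trans h2
    exact hrt (succ_edge_injective r t (Sym2.map.injective hc h3))
  · intro r x y h
    have hsub : ∀ (U : Fin 4 → Fin n), IsColoured χ c U →
        ∀ d : Dyad n, s(d.1.1, d.1.2) = s(U r, U (r + 1)) →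
          Sym2.map χ s(d.1.1, d.1.2) = s(c r, c (r + 1)) := fun U hU d hd => by
      rw [hd, Sym2.map_mk, hU, hU]
    exact congrArg₂ (· * ·)
      (dependsOn_stateInd (s r) (S r) (S (r + 1)) fun d hd => h d (hsub S hS d hd))
      (dependsOn_stateInd (s r) (S' r) (S' (r + 1)) fun d hd => h d (hsub S' hS' d hd))

/-- Expanded, the difference is the sum of all products with at least one factor `b`, and is
monotone in the nonnegative `a` and `b`. It allows dyad probabilities to be replaced by upper bounds
inside a covariance bound. -/
lemma prod_add_sub_prod_le {κ : Type*} (t : Finset κ) {a b a' b' : κ → ℝ}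
    (ha : ∀ k, 0 ≤ a k) (hb : ∀ k, 0 ≤ b k) (haa : ∀ k, a k ≤ a' k) (hbb : ∀ k, b k ≤ b' k) :
    ∏ k ∈ t, (a k + b k) - ∏ k ∈ t, a k ≤ ∏ k ∈ t, (a' k + b' k) - ∏ k ∈ t, a' k := by
  classical
  induction t using Finset.induction_on with
  | empty => simp
  | insert k t hk ih =>
    simp only [Finset.prod_insert hk]
    have h1 : 0 ≤ ∏ k ∈ t, a k := Finset.prod_nonneg fun k _ => ha k
    have h2 : ∏ k ∈ t, a k ≤ ∏ k ∈ t, a' k := Finset.prod_le_prod (fun k _ => ha k) fun k _ => haa k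
    have h3 : ∏ k ∈ t, a k ≤ ∏ k ∈ t, (a k + b k) :=
      Finset.prod_le_prod (fun k _ => ha k) fun k _ => le_add_of_nonneg_right (hb k)
    have h4 : ∏ k ∈ t, (a k + b k) ≤ ∏ k ∈ t, (a' k + b' k) :=
      Finset.prod_le_prod (fun k _ => add_nonneg (ha k) (hb k)) fun k _ => add_le_add (haa k) (hbb k)
    have e1 := mul_le_mul (haa k) ih (sub_nonneg.2 h3) ((ha k).trans (haa k))
    have e2 := mul_le_mul (hbb k) h4 (h1.trans h3) ((hb k).trans (hbb k))
    linarith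

/-- Variance of a coloured count, in terms of upper bounds `f` for the dyad probabilities. -/
lemma P1Param.variance_colouredCount_le (θ : P1Param n) (hc : Function.Injective c)
    (s : Fin 4 → Bool × Bool) (f : Fin 4 → Fin n → Fin n → ℝ)
    (hf : ∀ r i j, θ.dyadProb i j (s r) ≤ f r i j) :
    Ex θ.dyadLaw (fun ω => (colouredCount χ c s ω - Ex θ.dyadLaw (colouredCount χ c s)) ^ 2) ≤
      ∑ S : Fin 4 → Fin n, ∑ S' : Fin 4 → Fin n,
        (∏ r, (f r (S r) (S (r + 1)) * f r (S' r) (S' (r + 1))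
            + sameDyad S S' r * f r (S r) (S (r + 1)))
          - ∏ r, (f r (S r) (S (r + 1)) * f r (S' r) (S' (r + 1)))) := by
  have hp := θ.isProbFamily_dyadLaw
  have hd : ∀ S S' : Fin 4 → Fin n, ∀ r, 0 ≤ sameDyad S S' r := fun S S' r => by
    unfold sameDyad; split_ifs <;> norm_num
  have h0 := fun i j s => θ.dyadProb_nonneg i j s
  have hf0 : ∀ r i j, 0 ≤ f r i j := fun r i j => (h0 _ _ _).trans (hf r i j)
  rw [hp.Ex_variance, θ.Ex_colouredCount hc, sq, Finset.sum_mul_sum]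
  have e : ∀ ω, colouredCount χ c s ω ^ 2 = ∑ S, ∑ S',
      (if IsColoured χ c S then cycleInd s ω S else 0) *
        (if IsColoured χ c S' then cycleInd s ω S' else 0) := fun ω => by
    rw [sq, colouredCount, Finset.sum_mul_sum]
  simp only [e, Ex_sum]
  rw [← Finset.sum_sub_distrib]
  refine Finset.sum_le_sum fun S _ => ?_
  rw [← Finset.sum_sub_distrib]
  refine Finset.sum_le_sum fun S' _ => ?_
  have hmono := prod_add_sub_prod_le Finset.univ
    (a := fun r => θ.dyadProb (S r) (S (r + 1)) (s r) * θ.dyadProb (S' r) (S' (r + 1)) (s r))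
    (b := fun r => sameDyad S S' r * θ.dyadProb (S r) (S (r + 1)) (s r))
    (a' := fun r => f r (S r) (S (r + 1)) * f r (S' r) (S' (r + 1)))
    (b' := fun r => sameDyad S S' r * f r (S r) (S (r + 1)))
    (fun r => mul_nonneg (h0 _ _ _) (h0 _ _ _)) (fun r => mul_nonneg (hd _ _ _) (h0 _ _ _))
    (fun r => mul_le_mul (hf _ _ _) (hf _ _ _) (h0 _ _ _) (hf0 _ _ _))
    (fun r => mul_le_mul_of_nonneg_left (hf _ _ _) (hd _ _ _))
  have hnn : 0 ≤ ∏ r, (f r (S r) (S (r + 1)) * f r (S' r) (S' (r + 1))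
            + sameDyad S S' r * f r (S r) (S (r + 1)))
          - ∏ r, (f r (S r) (S (r + 1)) * f r (S' r) (S' (r + 1))) :=
    sub_nonneg.2 (Finset.prod_le_prod (fun r _ => mul_nonneg (hf0 _ _ _) (hf0 _ _ _)) fun r _ =>
      le_add_of_nonneg_right (mul_nonneg (hd _ _ _) (hf0 _ _ _)))
  by_cases hS : IsColoured χ c S
  · by_cases hS' : IsColoured χ c S'
    · simp only [if_pos hS, if_pos hS']
      refine le_trans ?_ hmono
      rw [← Finset.prod_mul_distrib]
      exact sub_le_sub_right (θ.Ex_cycleInd_mul_le hc s hS hS') _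
    · simpa only [if_neg hS', mul_zero, hp.Ex_const, sub_zero] using hnn
  · simpa only [if_neg hS, zero_mul, hp.Ex_const, sub_zero] using hnn

end Coloured

/-! ### Bounding the variance sums by the rate. -/

lemma one_add_one_fin_four : (1 : Fin 4) + 1 = 2 := rfl

lemma two_add_one_fin_four : (2 : Fin 4) + 1 = 3 := rfl

lemma three_add_one_fin_four : (3 : Fin 4) + 1 = 0 := rfl

section PairSums

variable {n : ℕ}

/-- Once the dyad weights are regrouped by vertex, the sum over pairs of cycles is a product of four
sums over pairs of vertices. -/
lemma sum_sum_quad (F₀ F₁ F₂ F₃ : Fin n → Fin n → ℝ) :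
    ∑ S : Fin 4 → Fin n, ∑ S' : Fin 4 → Fin n,
      F₀ (S 0) (S' 0) * F₁ (S 1) (S' 1) * F₂ (S 2) (S' 2) * F₃ (S 3) (S' 3) =
    (∑ x, ∑ y, F₀ x y) * (∑ x, ∑ y, F₁ x y) * (∑ x, ∑ y, F₂ x y) * ∑ x, ∑ y, F₃ x y := by
  have h := Finset.prod_univ_sum (fun _ : Fin 4 => (Finset.univ : Finset (Fin n)))
    (fun v x => ∑ y, ![F₀, F₁, F₂, F₃] v x y)
  rw [Fin.prod_univ_four, Fintype.piFinset_univ] at h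
  refine Eq.trans (Finset.sum_congr rfl fun S _ => ?_) h.symm
  rw [Finset.prod_univ_sum, Fintype.piFinset_univ]
  refine Finset.sum_congr rfl fun S' _ => ?_
  rw [Fin.prod_univ_four]
  rfl

/-- The kernel `x_a x_b`. -/
def tensorKernel (x : Fin n → ℝ) (a b : Fin n) : ℝ := x a * x b

/-- The kernel `x_a 1{a = b}`. -/
def diagKernel (x : Fin n → ℝ) (a b : Fin n) : ℝ := if a = b then x a else 0

lemma sum_tensorKernel (x : Fin n → ℝ) : ∑ a, ∑ b, tensorKernel x a b = (∑ a, x a) ^ 2 := by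
  rw [sq, Finset.sum_mul_sum]; rfl

lemma sum_diagKernel (x : Fin n → ℝ) : ∑ a, ∑ b, diagKernel x a b = ∑ a, x a := by
  simp [diagKernel]

end PairSums

/-- Dyad probability bounds for the pattern of `Q_n(a)`. -/
def patternBoundA {n : ℕ} (e : ℝ) (μ ν : Fin n → ℝ) : Fin 4 → Fin n → Fin n → ℝ :=
  ![fun i j => e * (μ i * ν i) * (μ j * ν j), fun _ _ => 1, fun k l => ν k * μ l, fun _ _ => 1]

/-- Dyad probability bounds for the pattern of `Q_n(b)`. -/
def patternBoundB {n : ℕ} (μ ν : Fin n → ℝ) : Fin 4 → Fin n → Fin n → ℝ :=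
  ![fun i j => μ i * ν j, fun j k => μ j * ν k, fun _ _ => 1, fun l i => μ l * ν i]

/-- Terms with `a` or `b` use (1 + d)(1 + d') ≤ 4, the others d + d' + dd' ≤ d + 2d'. Here `d` and
`d'` stand for shared empty dyads, whose probability is bounded by 1. -/
lemma mul_two_perturbed_sub_le {A B a b d d' : ℝ} (hA : 0 ≤ A) (hB : 0 ≤ B) (ha : 0 ≤ a)
    (hb : 0 ≤ b) (hd : 0 ≤ d) (hd' : 0 ≤ d') (h1 : d ≤ 1) (h1' : d' ≤ 1) :
    (A + a) * (1 + d) * (B + b) * (1 + d') - A * B ≤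
      4 * (a * B) + 4 * (A * b) + 4 * (a * b) + A * B * d + 2 * (A * B * d') := by
  have h2 : (1 + d) * (1 + d') ≤ 4 := by nlinarith
  have h3 : 0 ≤ a * B + A * b + a * b := by positivity
  have h4 : d * d' ≤ d' := mul_le_of_le_one_left hd' h1
  nlinarith [mul_le_mul_of_nonneg_left h2 h3, mul_le_mul_of_nonneg_left h4 (mul_nonneg hA hB)]

lemma mul_three_perturbed_sub_le {A B C a b c d : ℝ} (hA : 0 ≤ A) (hB : 0 ≤ B) (hC : 0 ≤ C)
    (ha : 0 ≤ a) (hb : 0 ≤ b) (hc : 0 ≤ c) (h1 : d ≤ 1) :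
    (A + a) * (B + b) * (1 + d) * (C + c) - A * B * C ≤
      2 * (a * B * C) + 2 * (A * b * C) + 2 * (A * B * c) + 2 * (a * b * C) + 2 * (a * B * c)
        + 2 * (A * b * c) + 2 * (a * b * c) + A * B * C * d := by
  have h3 : 0 ≤ a * B * C + A * b * C + A * B * c + a * b * C + a * B * c + A * b * c
      + a * b * c := by positivity
  nlinarith [mul_le_mul_of_nonneg_left h1 h3]

/-- The relations between the norms `H = ‖η‖₁`, `M = ‖μ‖₁`, `N = ‖ν‖₁`, the inner products
`a = (μ, η)`, `b = (ν, η)` and a bound `r` for the rate. -/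
structure NormRelations (H M N a b r : ℝ) : Prop where
  one_le_H : 1 ≤ H
  one_le_M : 1 ≤ M
  one_le_N : 1 ≤ N
  a_nonneg : 0 ≤ a
  b_nonneg : 0 ≤ b
  le_aN : H ^ 2 ≤ a * N
  le_bM : H ^ 2 ≤ b * M
  ab_le : a * b ≤ r * H ^ 4

namespace NormRelations

variable {H M N a b r : ℝ} (h : NormRelations H M N a b r)
include h

lemma r_nonneg : 0 ≤ r := by
  have h1 := h.ab_le
  have h2 := mul_nonneg h.a_nonneg h.b_nonneg
  have h3 : 0 < H ^ 4 := pow_pos (by linarith [h.one_le_H]) 4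
  by_contra hr
  nlinarith [mul_pos_of_neg_of_neg (not_le.1 hr) (neg_lt_zero.2 h3)]

/-- The product of the two Cauchy–Schwarz relations is H⁴ ≤ ab·MN, and ab ≤ rH⁴. The bounds on `a`
and `b` below use one relation each in the same way. -/
lemma one_le_rMN : 1 ≤ r * (M * N) := by
  have h3 : 0 < H ^ 4 := pow_pos (by linarith [h.one_le_H]) 4
  have hM := h.one_le_M
  have hN := h.one_le_N
  have h4 : H ^ 4 ≤ r * (M * N) * H ^ 4 := by
    calc H ^ 4 = H ^ 2 * H ^ 2 := by ring
      _ ≤ (a * N) * (b * M) :=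
        mul_le_mul h.le_aN h.le_bM (sq_nonneg _) (mul_nonneg h.a_nonneg (by linarith))
      _ = a * b * (M * N) := by ring
      _ ≤ r * H ^ 4 * (M * N) := mul_le_mul_of_nonneg_right h.ab_le (by positivity)
      _ = _ := by ring
  by_contra hlt
  nlinarith [not_le.1 hlt]

lemma b_le : b ≤ r * H ^ 2 * N := by
  have h3 : 0 < H ^ 2 := pow_pos (by linarith [h.one_le_H]) 2
  refine le_of_mul_le_mul_right ?_ h3
  calc b * H ^ 2 ≤ b * (a * N) := mul_le_mul_of_nonneg_left h.le_aN h.b_nonneg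
    _ = a * b * N := by ring
    _ ≤ r * H ^ 4 * N := mul_le_mul_of_nonneg_right h.ab_le (by linarith [h.one_le_N])
    _ = _ := by ring

lemma a_le : a ≤ r * H ^ 2 * M := by
  have h3 : 0 < H ^ 2 := pow_pos (by linarith [h.one_le_H]) 2
  refine le_of_mul_le_mul_right ?_ h3
  calc a * H ^ 2 ≤ a * (b * M) := mul_le_mul_of_nonneg_left h.le_bM h.a_nonneg
    _ = a * b * M := by ring
    _ ≤ r * H ^ 4 * M := mul_le_mul_of_nonneg_right h.ab_le (by linarith [h.one_le_M])
    _ = _ := by ring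

end NormRelations

section VarianceSums

variable {n : ℕ} {μ ν : Fin n → ℝ} {e r : ℝ}

/-- The relations hold for vectors with entries in `[0, 1]`. -/
lemma normRelations (hμ0 : ∀ i, 0 ≤ μ i) (hν0 : ∀ i, 0 ≤ ν i) (hμ1 : ∀ i, μ i ≤ 1)
    (hν1 : ∀ i, ν i ≤ 1) (hH : 1 ≤ ∑ i, μ i * ν i)
    (hr : (∑ i, μ i * (μ i * ν i)) * (∑ i, ν i * (μ i * ν i)) ≤ r * (∑ i, μ i * ν i) ^ 4) :
    NormRelations (∑ i, μ i * ν i) (∑ i, μ i) (∑ i, ν i) (∑ i, μ i * (μ i * ν i))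
      (∑ i, ν i * (μ i * ν i)) r where
  one_le_H := hH
  one_le_M := hH.trans (Finset.sum_le_sum fun i _ => mul_le_of_le_one_right (hμ0 i) (hν1 i))
  one_le_N := hH.trans (Finset.sum_le_sum fun i _ => mul_le_of_le_one_left (hν0 i) (hμ1 i))
  a_nonneg := Finset.sum_nonneg fun i _ => mul_nonneg (hμ0 i) (mul_nonneg (hμ0 i) (hν0 i))
  b_nonneg := Finset.sum_nonneg fun i _ => mul_nonneg (hν0 i) (mul_nonneg (hμ0 i) (hν0 i))
  -- Cauchy–Schwarz from η² = (μη)·ν; symmetrically, η² = (νη)·μ below.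
  le_aN := Finset.sum_sq_le_sum_mul_sum_of_sq_le_mul _
    (fun i _ => mul_nonneg (hμ0 i) (mul_nonneg (hμ0 i) (hν0 i))) (fun i _ => hν0 i)
    fun i _ => le_of_eq (by ring)
  le_bM := Finset.sum_sq_le_sum_mul_sum_of_sq_le_mul _
    (fun i _ => mul_nonneg (hν0 i) (mul_nonneg (hμ0 i) (hν0 i))) (fun i _ => hμ0 i)
    fun i _ => le_of_eq (by ring)
  ab_le := hr

/-- A shared dyad identifies two corners of the cycles, turning their tensor kernels into diagonal
ones. Each of the five resulting sums is at most r times the square on the right, and their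
coefficients add up to 4 + 4 + 4 + 1 + 2 = 15. A shared double edge leads to the term 1/(e^ρ ‖η‖₁²)
of the rate. -/
lemma variance_sum_patternA_le (hμ0 : ∀ i, 0 ≤ μ i) (hν0 : ∀ i, 0 ≤ ν i) (hμ1 : ∀ i, μ i ≤ 1)
    (hν1 : ∀ i, ν i ≤ 1) (hH : 1 ≤ ∑ i, μ i * ν i) (he : 0 < e)
    (hr : (∑ i, μ i * (μ i * ν i)) * (∑ i, ν i * (μ i * ν i)) ≤ r * (∑ i, μ i * ν i) ^ 4)
    (hr' : 1 ≤ r * (e * (∑ i, μ i * ν i) ^ 2)) :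
    ∑ S : Fin 4 → Fin n, ∑ S' : Fin 4 → Fin n,
        (∏ t, (patternBoundA e μ ν t (S t) (S (t + 1)) * patternBoundA e μ ν t (S' t) (S' (t + 1))
            + sameDyad S S' t * patternBoundA e μ ν t (S t) (S (t + 1)))
          - ∏ t, (patternBoundA e μ ν t (S t) (S (t + 1)) *
              patternBoundA e μ ν t (S' t) (S' (t + 1)))) ≤
      15 * r * (e * (∑ i, μ i * ν i) ^ 2 * (∑ i, μ i) * ∑ i, ν i) ^ 2 := by
  have h := normRelations hμ0 hν0 hμ1 hν1 hH hr
  set η : Fin n → ℝ := fun i => μ i * ν i with hη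
  have hη0 : ∀ i, 0 ≤ η i := fun i => mul_nonneg (hμ0 i) (hν0 i)
  set H := ∑ i, μ i * ν i
  set M := ∑ i, μ i
  set N := ∑ i, ν i
  set a := ∑ i, μ i * (μ i * ν i)
  set b := ∑ i, ν i * (μ i * ν i)
  have hSη : ∑ i, η i = H := rfl
  set K : (Fin n → Fin n → ℝ) → (Fin n → Fin n → ℝ) → (Fin n → Fin n → ℝ) →
    (Fin n → Fin n → ℝ) → (Fin 4 → Fin n) → (Fin 4 → Fin n) → ℝ := fun F₀ F₁ F₂ F₃ S S' =>
      F₀ (S 0) (S' 0) * F₁ (S 1) (S' 1) * F₂ (S 2) (S' 2) * F₃ (S 3) (S' 3) with hK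
  have hKs : ∀ F₀ F₁ F₂ F₃, ∑ S, ∑ S', K F₀ F₁ F₂ F₃ S S' = _ := fun F₀ F₁ F₂ F₃ =>
    sum_sum_quad F₀ F₁ F₂ F₃
  have pt : ∀ S S' : Fin 4 → Fin n,
      (∏ t, (patternBoundA e μ ν t (S t) (S (t + 1)) * patternBoundA e μ ν t (S' t) (S' (t + 1))
            + sameDyad S S' t * patternBoundA e μ ν t (S t) (S (t + 1)))
          - ∏ t, (patternBoundA e μ ν t (S t) (S (t + 1)) *
              patternBoundA e μ ν t (S' t) (S' (t + 1)))) ≤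
        4 * e * K (diagKernel η) (diagKernel η) (tensorKernel ν) (tensorKernel μ) S S'
        + 4 * e ^ 2 * K (tensorKernel η) (tensorKernel η) (diagKernel ν) (diagKernel μ) S S'
        + 4 * e * K (diagKernel η) (diagKernel η) (diagKernel ν) (diagKernel μ) S S'
        + e ^ 2 * K (tensorKernel η) (diagKernel (fun i => η i ^ 2))
            (diagKernel (fun i => ν i ^ 2)) (tensorKernel μ) S S'
        + 2 * e ^ 2 * K (diagKernel (fun i => η i ^ 2)) (tensorKernel η)
            (tensorKernel ν) (diagKernel (fun i => μ i ^ 2)) S S' := by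
    intro S S'
    have q1 : ∀ t, 0 ≤ sameDyad S S' t := fun t => by
      unfold sameDyad; split_ifs <;> norm_num
    have q2 : ∀ t, sameDyad S S' t ≤ 1 := fun t => by
      unfold sameDyad; split_ifs <;> norm_num
    have pA : 0 ≤ e * η (S 0) * η (S 1) * (e * η (S' 0) * η (S' 1)) :=
      mul_nonneg (mul_nonneg (mul_nonneg he.le (hη0 _)) (hη0 _))
        (mul_nonneg (mul_nonneg he.le (hη0 _)) (hη0 _))
    have pB : 0 ≤ ν (S 2) * μ (S 3) * (ν (S' 2) * μ (S' 3)) :=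
      mul_nonneg (mul_nonneg (hν0 _) (hμ0 _)) (mul_nonneg (hν0 _) (hμ0 _))
    have pa : 0 ≤ sameDyad S S' 0 * (e * η (S 0) * η (S 1)) :=
      mul_nonneg (q1 0) (mul_nonneg (mul_nonneg he.le (hη0 _)) (hη0 _))
    have pb : 0 ≤ sameDyad S S' 2 * (ν (S 2) * μ (S 3)) :=
      mul_nonneg (q1 2) (mul_nonneg (hν0 _) (hμ0 _))
    have main := mul_two_perturbed_sub_le pA pB pa pb (q1 1) (q1 3) (q2 1) (q2 3)
    have e1 : ∏ t, (patternBoundA e μ ν t (S t) (S (t + 1)) *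
        patternBoundA e μ ν t (S' t) (S' (t + 1))
            + sameDyad S S' t * patternBoundA e μ ν t (S t) (S (t + 1))) =
        (e * η (S 0) * η (S 1) * (e * η (S' 0) * η (S' 1)) +
          sameDyad S S' 0 * (e * η (S 0) * η (S 1))) * (1 + sameDyad S S' 1) *
        (ν (S 2) * μ (S 3) * (ν (S' 2) * μ (S' 3)) + sameDyad S S' 2 * (ν (S 2) * μ (S 3))) *
        (1 + sameDyad S S' 3) := by
      rw [Fin.prod_univ_four]
      simp only [patternBoundA, Matrix.cons_val, hη, zero_add, one_add_one_fin_four, two_add_one_fin_four,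
        three_add_one_fin_four]
      ring
    have e2 : ∏ t, (patternBoundA e μ ν t (S t) (S (t + 1)) *
        patternBoundA e μ ν t (S' t) (S' (t + 1))) =
        (e * η (S 0) * η (S 1) * (e * η (S' 0) * η (S' 1))) *
        (ν (S 2) * μ (S 3) * (ν (S' 2) * μ (S' 3))) := by
      rw [Fin.prod_univ_four]
      simp only [patternBoundA, Matrix.cons_val, hη, zero_add, one_add_one_fin_four, two_add_one_fin_four,
        three_add_one_fin_four]
      ring
    rw [e1, e2]
    refine main.trans (le_of_eq ?_)
    have s0 : sameDyad S S' 0 = (if S 0 = S' 0 then 1 else 0) * (if S 1 = S' 1 then 1 else 0) := rfl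
    have s1 : sameDyad S S' 1 = (if S 1 = S' 1 then 1 else 0) * (if S 2 = S' 2 then 1 else 0) := rfl
    have s2 : sameDyad S S' 2 = (if S 2 = S' 2 then 1 else 0) * (if S 3 = S' 3 then 1 else 0) := rfl
    have s3 : sameDyad S S' 3 = (if S 3 = S' 3 then 1 else 0) * (if S 0 = S' 0 then 1 else 0) := rfl
    simp only [s0, s1, s2, s3, hK, diagKernel, tensorKernel]
    congr 1
    · congr 1
      · congr 1
        · congr 1
          · split_ifs <;> ring
          · split_ifs <;> ring
        · split_ifs <;> ring
      · split_ifs with h1 h2 <;> simp only [mul_zero, zero_mul, mul_one]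
        rw [← h1, ← h2]; ring
    · split_ifs with h1 h2 <;> simp only [mul_zero, zero_mul, mul_one]
      rw [← h1, ← h2]; ring
  refine (Finset.sum_le_sum fun S _ => Finset.sum_le_sum fun S' _ => pt S S').trans ?_
  simp only [Finset.sum_add_distrib, ← Finset.mul_sum, hKs, sum_diagKernel, sum_tensorKernel]
  rw [hSη]
  change 4 * e * (H * H * N ^ 2 * M ^ 2) + 4 * e ^ 2 * (H ^ 2 * H ^ 2 * N * M)
    + 4 * e * (H * H * N * M) + e ^ 2 * (H ^ 2 * (∑ i, η i ^ 2) * (∑ i, ν i ^ 2) * M ^ 2)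
    + 2 * e ^ 2 * ((∑ i, η i ^ 2) * H ^ 2 * N ^ 2 * ∑ i, μ i ^ 2) ≤ _
  have hH1 := h.one_le_H
  have hM1 := h.one_le_M
  have hN1 := h.one_le_N
  have hr0 := h.r_nonneg
  have hνs : ∑ i, ν i ^ 2 ≤ N := Finset.sum_le_sum fun i _ => by
    nlinarith [hν0 i, hν1 i]
  have hμs : ∑ i, μ i ^ 2 ≤ M := Finset.sum_le_sum fun i _ => by
    nlinarith [hμ0 i, hμ1 i]
  have hηb : ∑ i, η i ^ 2 ≤ b := Finset.sum_le_sum fun i _ => by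
    have : μ i * (ν i * (μ i * ν i)) ≤ 1 * (ν i * (μ i * ν i)) :=
      mul_le_mul_of_nonneg_right (hμ1 i) (mul_nonneg (hν0 i) (hη0 i))
    simp only [hη]; nlinarith
  have hηa : ∑ i, η i ^ 2 ≤ a := Finset.sum_le_sum fun i _ => by
    have : ν i * (μ i * (μ i * ν i)) ≤ 1 * (μ i * (μ i * ν i)) :=
      mul_le_mul_of_nonneg_right (hν1 i) (mul_nonneg (hμ0 i) (hη0 i))
    simp only [hη]; nlinarith
  have hMN : 1 ≤ M * N := one_le_mul_of_one_le_of_one_le hM1 hN1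
  set E := e * H ^ 2 * M * N with hE
  have t1 : e * (H * H * N ^ 2 * M ^ 2) ≤ r * E ^ 2 := by
    calc e * (H * H * N ^ 2 * M ^ 2) = 1 * (e * H ^ 2 * (M * N) ^ 2) := by ring
      _ ≤ r * (e * H ^ 2) * (e * H ^ 2 * (M * N) ^ 2) :=
        mul_le_mul_of_nonneg_right hr' (by positivity)
      _ = _ := by rw [hE]; ring
  have t2 : e ^ 2 * (H ^ 2 * H ^ 2 * N * M) ≤ r * E ^ 2 := by
    calc e ^ 2 * (H ^ 2 * H ^ 2 * N * M) = 1 * (e ^ 2 * H ^ 4 * (M * N)) := by ring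
      _ ≤ r * (M * N) * (e ^ 2 * H ^ 4 * (M * N)) :=
        mul_le_mul_of_nonneg_right h.one_le_rMN (by positivity)
      _ = _ := by rw [hE]; ring
  have t3 : e * (H * H * N * M) ≤ r * E ^ 2 := by
    refine le_trans ?_ t1
    calc e * (H * H * N * M) = e * H ^ 2 * (M * N) * 1 := by ring
      _ ≤ e * H ^ 2 * (M * N) * (M * N) := mul_le_mul_of_nonneg_left hMN (by positivity)
      _ = _ := by ring
  have hη20 : 0 ≤ ∑ i, η i ^ 2 := Finset.sum_nonneg fun i _ => sq_nonneg _
  have t4 : e ^ 2 * (H ^ 2 * (∑ i, η i ^ 2) * (∑ i, ν i ^ 2) * M ^ 2) ≤ r * E ^ 2 := by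
    calc e ^ 2 * (H ^ 2 * (∑ i, η i ^ 2) * (∑ i, ν i ^ 2) * M ^ 2)
        ≤ e ^ 2 * (H ^ 2 * (r * H ^ 2 * N) * N * M ^ 2) := by
          have := hηb.trans h.b_le
          gcongr
      _ = _ := by rw [hE]; ring
  have t5 : e ^ 2 * ((∑ i, η i ^ 2) * H ^ 2 * N ^ 2 * ∑ i, μ i ^ 2) ≤ r * E ^ 2 := by
    calc e ^ 2 * ((∑ i, η i ^ 2) * H ^ 2 * N ^ 2 * ∑ i, μ i ^ 2)
        ≤ e ^ 2 * ((r * H ^ 2 * M) * H ^ 2 * N ^ 2 * M) := by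
          have := hηa.trans h.a_le
          gcongr
      _ = _ := by rw [hE]; ring
  linarith

/-- The same scheme, with coefficients 7·2 + 1 = 15. Sharing only the edge in position 0 gives its
ends the weights νη and μη, which is where the term (μ, η)(ν, η)/‖η‖₁⁴ of the rate comes from. -/
lemma variance_sum_patternB_le (hμ0 : ∀ i, 0 ≤ μ i) (hν0 : ∀ i, 0 ≤ ν i) (hμ1 : ∀ i, μ i ≤ 1)
    (hν1 : ∀ i, ν i ≤ 1) (hH : 1 ≤ ∑ i, μ i * ν i)
    (hr : (∑ i, μ i * (μ i * ν i)) * (∑ i, ν i * (μ i * ν i)) ≤ r * (∑ i, μ i * ν i) ^ 4) :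
    ∑ S : Fin 4 → Fin n, ∑ S' : Fin 4 → Fin n,
        (∏ t, (patternBoundB μ ν t (S t) (S (t + 1)) * patternBoundB μ ν t (S' t) (S' (t + 1))
            + sameDyad S S' t * patternBoundB μ ν t (S t) (S (t + 1)))
          - ∏ t, (patternBoundB μ ν t (S t) (S (t + 1)) *
              patternBoundB μ ν t (S' t) (S' (t + 1)))) ≤
      15 * r * ((∑ i, μ i * ν i) ^ 2 * (∑ i, μ i) * ∑ i, ν i) ^ 2 := by
  have h := normRelations hμ0 hν0 hμ1 hν1 hH hr
  set η : Fin n → ℝ := fun i => μ i * ν i with hη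
  set x : Fin n → ℝ := fun i => μ i * (μ i * ν i) with hx
  set y : Fin n → ℝ := fun i => ν i * (μ i * ν i) with hy
  set H := ∑ i, μ i * ν i
  set M := ∑ i, μ i
  set N := ∑ i, ν i
  set a := ∑ i, μ i * (μ i * ν i)
  set b := ∑ i, ν i * (μ i * ν i)
  have hSη : ∑ i, η i = H := rfl
  have hSx : ∑ i, x i = a := rfl
  have hSy : ∑ i, y i = b := rfl
  set K : (Fin n → Fin n → ℝ) → (Fin n → Fin n → ℝ) → (Fin n → Fin n → ℝ) →
    (Fin n → Fin n → ℝ) → (Fin 4 → Fin n) → (Fin 4 → Fin n) → ℝ := fun F₀ F₁ F₂ F₃ S S' =>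
      F₀ (S 0) (S' 0) * F₁ (S 1) (S' 1) * F₂ (S 2) (S' 2) * F₃ (S 3) (S' 3) with hK
  have hKs : ∀ F₀ F₁ F₂ F₃, ∑ S, ∑ S', K F₀ F₁ F₂ F₃ S S' = _ := fun F₀ F₁ F₂ F₃ =>
    sum_sum_quad F₀ F₁ F₂ F₃
  have pt : ∀ S S' : Fin 4 → Fin n,
      (∏ t, (patternBoundB μ ν t (S t) (S (t + 1)) * patternBoundB μ ν t (S' t) (S' (t + 1))
            + sameDyad S S' t * patternBoundB μ ν t (S t) (S (t + 1)))
          - ∏ t, (patternBoundB μ ν t (S t) (S (t + 1)) *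
              patternBoundB μ ν t (S' t) (S' (t + 1)))) ≤
        2 * K (diagKernel y) (diagKernel x) (tensorKernel ν) (tensorKernel μ) S S'
        + 2 * K (tensorKernel η) (diagKernel y) (diagKernel ν) (tensorKernel μ) S S'
        + 2 * K (diagKernel x) (tensorKernel η) (tensorKernel ν) (diagKernel μ) S S'
        + 2 * K (diagKernel y) (diagKernel η) (diagKernel ν) (tensorKernel μ) S S'
        + 2 * K (diagKernel η) (diagKernel x) (tensorKernel ν) (diagKernel μ) S S'
        + 2 * K (diagKernel x) (diagKernel y) (diagKernel ν) (diagKernel μ) S S'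
        + 2 * K (diagKernel η) (diagKernel η) (diagKernel ν) (diagKernel μ) S S'
        + K (tensorKernel η) (tensorKernel η) (diagKernel (fun i => ν i ^ 2))
            (diagKernel (fun i => μ i ^ 2)) S S' := by
    intro S S'
    have q1 : ∀ t, 0 ≤ sameDyad S S' t := fun t => by
      unfold sameDyad; split_ifs <;> norm_num
    have q2 : ∀ t, sameDyad S S' t ≤ 1 := fun t => by
      unfold sameDyad; split_ifs <;> norm_num
    have w : ∀ i j, 0 ≤ μ i * ν j := fun i j => mul_nonneg (hμ0 i) (hν0 j)
    have main := mul_three_perturbed_sub_le (mul_nonneg (w (S 0) (S 1)) (w (S' 0) (S' 1)))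
      (mul_nonneg (w (S 1) (S 2)) (w (S' 1) (S' 2))) (mul_nonneg (w (S 3) (S 0)) (w (S' 3) (S' 0)))
      (mul_nonneg (q1 0) (w (S 0) (S 1))) (mul_nonneg (q1 1) (w (S 1) (S 2)))
      (mul_nonneg (q1 3) (w (S 3) (S 0))) (q2 2)
    have e1 : ∏ t, (patternBoundB μ ν t (S t) (S (t + 1)) *
        patternBoundB μ ν t (S' t) (S' (t + 1))
            + sameDyad S S' t * patternBoundB μ ν t (S t) (S (t + 1))) =
        (μ (S 0) * ν (S 1) * (μ (S' 0) * ν (S' 1)) + sameDyad S S' 0 * (μ (S 0) * ν (S 1))) *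
        (μ (S 1) * ν (S 2) * (μ (S' 1) * ν (S' 2)) + sameDyad S S' 1 * (μ (S 1) * ν (S 2))) *
        (1 + sameDyad S S' 2) *
        (μ (S 3) * ν (S 0) * (μ (S' 3) * ν (S' 0)) + sameDyad S S' 3 * (μ (S 3) * ν (S 0))) := by
      rw [Fin.prod_univ_four]
      simp only [patternBoundB, Matrix.cons_val, zero_add, one_add_one_fin_four, two_add_one_fin_four,
        three_add_one_fin_four]
      ring
    have e2 : ∏ t, (patternBoundB μ ν t (S t) (S (t + 1)) *
        patternBoundB μ ν t (S' t) (S' (t + 1))) =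
        (μ (S 0) * ν (S 1) * (μ (S' 0) * ν (S' 1))) *
        (μ (S 1) * ν (S 2) * (μ (S' 1) * ν (S' 2))) *
        (μ (S 3) * ν (S 0) * (μ (S' 3) * ν (S' 0))) := by
      rw [Fin.prod_univ_four]
      simp only [patternBoundB, Matrix.cons_val, zero_add, one_add_one_fin_four, two_add_one_fin_four,
        three_add_one_fin_four]
      ring
    rw [e1, e2]
    refine main.trans (le_of_eq ?_)
    have s0 : sameDyad S S' 0 = (if S 0 = S' 0 then 1 else 0) * (if S 1 = S' 1 then 1 else 0) := rfl
    have s1 : sameDyad S S' 1 = (if S 1 = S' 1 then 1 else 0) * (if S 2 = S' 2 then 1 else 0) := rfl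
    have s2 : sameDyad S S' 2 = (if S 2 = S' 2 then 1 else 0) * (if S 3 = S' 3 then 1 else 0) := rfl
    have s3 : sameDyad S S' 3 = (if S 3 = S' 3 then 1 else 0) * (if S 0 = S' 0 then 1 else 0) := rfl
    simp only [s0, s1, s2, s3, hK, diagKernel, tensorKernel, hη, hx, hy]
    by_cases h0 : S 0 = S' 0 <;> by_cases h1 : S 1 = S' 1 <;> by_cases h2 : S 2 = S' 2 <;>
      by_cases h3 : S 3 = S' 3 <;> simp only [h0, h1, h2, h3, if_true, if_false] <;> ring
  refine (Finset.sum_le_sum fun S _ => Finset.sum_le_sum fun S' _ => pt S S').trans ?_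
  simp only [Finset.sum_add_distrib, ← Finset.mul_sum, hKs, sum_diagKernel, sum_tensorKernel]
  rw [hSη, hSx, hSy]
  change 2 * (b * a * N ^ 2 * M ^ 2) + 2 * (H ^ 2 * b * N * M ^ 2) + 2 * (a * H ^ 2 * N ^ 2 * M)
    + 2 * (b * H * N * M ^ 2) + 2 * (H * a * N ^ 2 * M) + 2 * (a * b * N * M)
    + 2 * (H * H * N * M) + H ^ 2 * H ^ 2 * (∑ i, ν i ^ 2) * (∑ i, μ i ^ 2) ≤ _
  have hH1 := h.one_le_H
  have hM1 := h.one_le_M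
  have hN1 := h.one_le_N
  have ha0 := h.a_nonneg
  have hb0 := h.b_nonneg
  have hr0 := h.r_nonneg
  have hνs : ∑ i, ν i ^ 2 ≤ N := Finset.sum_le_sum fun i _ => by
    nlinarith [hν0 i, hν1 i]
  have hμs : ∑ i, μ i ^ 2 ≤ M := Finset.sum_le_sum fun i _ => by
    nlinarith [hμ0 i, hμ1 i]
  have hMN : 1 ≤ M * N := one_le_mul_of_one_le_of_one_le hM1 hN1
  have hHH : H ≤ H ^ 2 := by nlinarith
  set E := H ^ 2 * M * N with hE
  have t1 : b * a * N ^ 2 * M ^ 2 ≤ r * E ^ 2 := by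
    calc b * a * N ^ 2 * M ^ 2 = a * b * (M * N) ^ 2 := by ring
      _ ≤ r * H ^ 4 * (M * N) ^ 2 := mul_le_mul_of_nonneg_right h.ab_le (by positivity)
      _ = _ := by rw [hE]; ring
  have t2 : H ^ 2 * b * N * M ^ 2 ≤ r * E ^ 2 := by
    calc H ^ 2 * b * N * M ^ 2 ≤ H ^ 2 * (r * H ^ 2 * N) * N * M ^ 2 := by
          have := h.b_le
          gcongr
      _ = _ := by rw [hE]; ring
  have t3 : a * H ^ 2 * N ^ 2 * M ≤ r * E ^ 2 := by
    calc a * H ^ 2 * N ^ 2 * M ≤ r * H ^ 2 * M * H ^ 2 * N ^ 2 * M := by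
          have := h.a_le
          gcongr
      _ = _ := by rw [hE]; ring
  have t4 : b * H * N * M ^ 2 ≤ r * E ^ 2 := by
    refine le_trans ?_ t2
    calc b * H * N * M ^ 2 ≤ b * H ^ 2 * N * M ^ 2 := by gcongr
      _ = _ := by ring
  have t5 : H * a * N ^ 2 * M ≤ r * E ^ 2 := by
    refine le_trans ?_ t3
    calc H * a * N ^ 2 * M ≤ H ^ 2 * a * N ^ 2 * M := by gcongr
      _ = _ := by ring
  have t6 : a * b * N * M ≤ r * E ^ 2 := by
    refine le_trans ?_ t1
    calc a * b * N * M = a * b * (M * N) * 1 := by ring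
      _ ≤ a * b * (M * N) * (M * N) := mul_le_mul_of_nonneg_left hMN (by positivity)
      _ = _ := by ring
  have t8 : H ^ 2 * H ^ 2 * N * M ≤ r * E ^ 2 := by
    calc H ^ 2 * H ^ 2 * N * M = 1 * (H ^ 4 * (M * N)) := by ring
      _ ≤ r * (M * N) * (H ^ 4 * (M * N)) :=
        mul_le_mul_of_nonneg_right h.one_le_rMN (by positivity)
      _ = _ := by rw [hE]; ring
  have t7 : H * H * N * M ≤ r * E ^ 2 := by
    refine le_trans ?_ t8
    gcongr
  have t9 : H ^ 2 * H ^ 2 * (∑ i, ν i ^ 2) * (∑ i, μ i ^ 2) ≤ r * E ^ 2 := by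
    refine le_trans ?_ t8
    gcongr
  linarith

end VarianceSums

/-! ### Random colourings: decoupling and balance. -/

section RandomColouring

variable {n : ℕ} {C : Type} [Fintype C] [DecidableEq C] [Nonempty C]

/-- Independent uniform colours. -/
def uniformColouring (n : ℕ) (C : Type) [Fintype C] : Fin n → C → ℝ :=
  fun _ _ => (Fintype.card C : ℝ)⁻¹

omit [DecidableEq C] in
lemma isProbFamily_uniformColouring : IsProbFamily (uniformColouring n C) :=
  ⟨fun _ _ => by unfold uniformColouring; positivity, fun _ => by simp [uniformColouring]⟩

/-- Probability that an injective quadruple receives the prescribed colours. -/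
lemma Ex_isColoured [Inhabited C] (c : Fin 4 → C) {S : Fin 4 → Fin n}
    (hS : Function.Injective S) :
    Ex (uniformColouring n C) (fun χ => if IsColoured χ c S then 1 else 0) =
      ((Fintype.card C : ℝ)⁻¹) ^ 4 := by
  have hp := isProbFamily_uniformColouring (n := n) (C := C)
  have h1 : ∀ χ : Fin n → C, (if IsColoured χ c S then (1 : ℝ) else 0) =
      ∏ r, if χ (S r) = c r then 1 else 0 := fun χ => by
    rw [Finset.prod_ite_zero]; simp [IsColoured]
  simp only [h1]
  rw [hp.Ex_prod_of_dependsOn Finset.univ (D := fun r => {S r})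
    (g := fun r χ => if χ (S r) = c r then 1 else 0)]
  · have h2 : ∀ r, Ex (uniformColouring n C) (fun χ => if χ (S r) = c r then (1 : ℝ) else 0) =
        (Fintype.card C : ℝ)⁻¹ := fun r => by
      rw [hp.Ex_coord (S r) (fun t => if t = c r then 1 else 0)]
      simp [uniformColouring]
    simp [h2]
  · intro r t hrt
    exact Set.disjoint_singleton.2 fun h => hrt (hS h)
  · intro r x y h
    simp only [h (S r) rfl]

/-- The full count is an average of coloured counts. -/
lemma Ex_colouredCount_uniform (s : Fin 4 → Bool × Bool) (ω : Config n) :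
    Ex (uniformColouring n (Fin 4)) (fun χ => colouredCount χ id s ω) =
      (1 / 256) * cycleCount s ω := by
  unfold colouredCount cycleCount
  rw [Ex_sum, Finset.mul_sum]
  refine Finset.sum_congr rfl fun S _ => ?_
  split_ifs with hS
  · have h1 : ∀ χ : Fin n → Fin 4, (if IsColoured χ id S then cycleInd s ω S else 0) =
        cycleInd s ω S * if IsColoured χ id S then 1 else 0 := fun χ => by simp
    simp only [h1]
    rw [Ex_const_mul, Ex_isColoured id hS]
    simp only [Fintype.card_fin]
    push_cast
    ring
  · have h1 : ∀ χ : Fin n → Fin 4, (if IsColoured χ id S then cycleInd s ω S else 0) = 0 :=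
      fun χ => if_neg fun h => hS (h.injective Function.injective_id)
    simp only [h1]
    rw [isProbFamily_uniformColouring.Ex_const, mul_zero]

/-- Decoupling: a uniform variance bound for coloured counts gives one for the full count. -/
lemma P1Param.variance_cycleCount_le (θ : P1Param n) (s : Fin 4 → Bool × Bool) {V : ℝ}
    (hV : ∀ χ : Fin n → Fin 4, Ex θ.dyadLaw (fun ω =>
      (colouredCount χ id s ω - Ex θ.dyadLaw (colouredCount χ id s)) ^ 2) ≤ V) :
    Ex θ.dyadLaw (fun ω => (cycleCount s ω - Ex θ.dyadLaw (cycleCount s)) ^ 2) ≤ 256 ^ 2 * V := by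
  have hp := θ.isProbFamily_dyadLaw
  have hu := isProbFamily_uniformColouring (n := n) (C := Fin 4)
  have h1 : ∀ ω : Config n, cycleCount s ω =
      256 * Ex (uniformColouring n (Fin 4)) (fun χ => colouredCount χ id s ω) := fun ω => by
    rw [Ex_colouredCount_uniform]; ring
  have h2 : Ex θ.dyadLaw (cycleCount s) = 256 * Ex (uniformColouring n (Fin 4))
      (fun χ => Ex θ.dyadLaw (colouredCount χ id s)) := by
    rw [show cycleCount s = _ from funext h1, Ex_const_mul, Ex_comm]
  have h3 : ∀ ω, (cycleCount s ω - Ex θ.dyadLaw (cycleCount s)) ^ 2 ≤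
      256 ^ 2 * Ex (uniformColouring n (Fin 4)) (fun χ =>
        (colouredCount χ id s ω - Ex θ.dyadLaw (colouredCount χ id s)) ^ 2) := fun ω => by
    rw [h1, h2, ← mul_sub, ← Ex_sub, mul_pow]
    exact mul_le_mul_of_nonneg_left (hu.sq_Ex_le _) (by norm_num)
  refine (hp.Ex_mono h3).trans ?_
  rw [Ex_const_mul, Ex_comm]
  refine mul_le_mul_of_nonneg_left ?_ (by norm_num)
  exact (hu.Ex_mono hV).trans (hu.Ex_const V).le

/-- Total weight of a colour class. -/
def classWeight (χ : Fin n → C) (c : C) (w : Fin n → ℝ) : ℝ := ∑ i, if χ i = c then w i else 0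

/-- The deviation is a weighted sum of independent centred indicators; the cross terms vanish and
each variance is at most the probability of the colour. -/
lemma Ex_classWeight_sub_sq_le [Inhabited C] (w : Fin n → ℝ) (c : C) :
    Ex (uniformColouring n C)
        (fun χ => (classWeight χ c w - (Fintype.card C : ℝ)⁻¹ * ∑ i, w i) ^ 2) ≤
      (Fintype.card C : ℝ)⁻¹ * ∑ i, w i ^ 2 := by
  have hp := isProbFamily_uniformColouring (n := n) (C := C)
  have hcard : (Fintype.card C : ℝ) ≠ 0 := by simp
  set q : ℝ := (Fintype.card C : ℝ)⁻¹ with hq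
  have hq0 : 0 ≤ q := by positivity
  set g : C → ℝ := fun t => (if t = c then 1 else 0) - q with hg
  have h1 : ∀ χ : Fin n → C, (classWeight χ c w - q * ∑ i, w i) ^ 2 =
      ∑ i, ∑ j, w i * w j * (g (χ i) * g (χ j)) := fun χ => by
    have : classWeight χ c w - q * ∑ i, w i = ∑ i, w i * g (χ i) := by
      rw [classWeight, Finset.mul_sum, ← Finset.sum_sub_distrib]
      exact Finset.sum_congr rfl fun i _ => by simp only [hg]; split_ifs <;> ring
    rw [this, sq, Finset.sum_mul_sum]
    exact Finset.sum_congr rfl fun i _ => Finset.sum_congr rfl fun j _ => by ring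
  have hmean : ∀ i, Ex (uniformColouring n C) (fun χ => g (χ i)) = 0 := fun i => by
    rw [hp.Ex_coord i g]
    simp only [uniformColouring, hg, ← hq]
    rw [← Finset.mul_sum, Finset.sum_sub_distrib]
    simp [hq]
  have hsq : ∀ i, Ex (uniformColouring n C) (fun χ => g (χ i) * g (χ i)) ≤ q := fun i => by
    rw [hp.Ex_coord i (fun t => g t * g t)]
    simp only [uniformColouring, hg, ← hq]
    have : ∀ t : C, q * (((if t = c then 1 else 0) - q) * ((if t = c then 1 else 0) - q)) =
        (q - 2 * q ^ 2) * (if t = c then 1 else 0) + q ^ 3 := fun t => by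
      split_ifs <;> ring
    simp only [this]
    rw [Finset.sum_add_distrib, ← Finset.mul_sum]
    simp only [Finset.sum_ite_eq', Finset.mem_univ, if_true, Finset.sum_const, Finset.card_univ,
      nsmul_eq_mul, mul_one]
    have : (Fintype.card C : ℝ) * q ^ 3 = q ^ 2 := by rw [hq]; field_simp
    nlinarith [sq_nonneg q]
  simp only [h1, Ex_sum, Ex_const_mul]
  rw [Finset.mul_sum]
  refine Finset.sum_le_sum fun i _ => ?_
  rw [Finset.sum_eq_single i]
  · nlinarith [mul_le_mul_of_nonneg_left (hsq i) (sq_nonneg (w i))]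
  · intro j _ hj
    rw [hp.Ex_mul_of_dependsOn (D := {i}) (D' := {j}) (Set.disjoint_singleton.2 hj.symm)
      (fun x y h => by rw [h i rfl]) (fun x y h => by rw [h j rfl]), hmean, zero_mul, mul_zero]
  · simp

/-- If all weights are spread out, then some colouring shares each of them almost evenly. -/
lemma exists_balanced_colouring [Inhabited C] {κ : Type*} [Fintype κ] (w : κ → Fin n → ℝ)
    (h0 : ∀ k i, 0 ≤ w k i) (h1 : ∀ k i, w k i ≤ 1)
    (hW : ∀ k, 4 * Fintype.card κ * (Fintype.card C : ℝ) ^ 2 ≤ ∑ i, w k i)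
    (hκ : Nonempty κ) :
    ∃ χ : Fin n → C, ∀ k c,
      (2 * (Fintype.card C : ℝ))⁻¹ * ∑ i, w k i ≤ classWeight χ c (w k) := by
  have hp := isProbFamily_uniformColouring (n := n) (C := C)
  have hN : 0 < (Fintype.card C : ℝ) := by exact_mod_cast Fintype.card_pos
  have hK : 0 < (Fintype.card κ : ℝ) := by exact_mod_cast Fintype.card_pos
  have hWpos : ∀ k, 0 < ∑ i, w k i := fun k => lt_of_lt_of_le (by positivity) (hW k)
  set N : ℝ := (Fintype.card C : ℝ)
  -- The total squared deviation relative to the full weights. Its mean is at most (1/(2N))², so at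
  -- a minimizer every class is within half of its fair share 1/N.
  set F : (Fin n → C) → ℝ := fun χ => ∑ k, ∑ c,
    ((∑ i, w k i) ^ 2)⁻¹ * (classWeight χ c (w k) - N⁻¹ * ∑ i, w k i) ^ 2 with hF
  have hEx : Ex (uniformColouring n C) F ≤ (2 * N)⁻¹ ^ 2 := by
    simp only [hF, Ex_sum, Ex_const_mul]
    have hb : ∀ k (c : C), ((∑ i, w k i) ^ 2)⁻¹ * Ex (uniformColouring n C)
        (fun χ => (classWeight χ c (w k) - N⁻¹ * ∑ i, w k i) ^ 2) ≤
        N⁻¹ * (4 * Fintype.card κ * N ^ 2)⁻¹ := fun k c => by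
      have e1 := Ex_classWeight_sub_sq_le (n := n) (w k) c
      have e2 : ∑ i, w k i ^ 2 ≤ ∑ i, w k i := Finset.sum_le_sum fun i _ => by
        nlinarith [h0 k i, h1 k i]
      have e3 : N⁻¹ * ∑ i, w k i ^ 2 ≤ N⁻¹ * ∑ i, w k i :=
        mul_le_mul_of_nonneg_left e2 (by positivity)
      have hWk := hWpos k
      calc _ ≤ ((∑ i, w k i) ^ 2)⁻¹ * (N⁻¹ * ∑ i, w k i) :=
            mul_le_mul_of_nonneg_left (e1.trans e3) (by positivity)
        _ = N⁻¹ * (∑ i, w k i)⁻¹ := by field_simp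
        _ ≤ _ := mul_le_mul_of_nonneg_left (inv_anti₀ (by positivity) (hW k)) (by positivity)
    refine (Finset.sum_le_sum fun k _ => Finset.sum_le_sum fun c _ => hb k c).trans (le_of_eq ?_)
    simp only [Finset.sum_const, Finset.card_univ, nsmul_eq_mul]
    change (Fintype.card κ : ℝ) * (N * (N⁻¹ * (4 * Fintype.card κ * N ^ 2)⁻¹)) = _
    field_simp
    norm_num
  obtain ⟨χ, hχ⟩ := Finite.exists_min F
  refine ⟨χ, fun k c => ?_⟩
  have hle : F χ ≤ (2 * N)⁻¹ ^ 2 := by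
    rw [← hp.Ex_const (F χ)]
    exact (hp.Ex_mono hχ).trans hEx
  have hnn : ∀ k (c : C), 0 ≤ ((∑ i, w k i) ^ 2)⁻¹ *
      (classWeight χ c (w k) - N⁻¹ * ∑ i, w k i) ^ 2 := fun k c => by positivity
  have hterm : ((∑ i, w k i) ^ 2)⁻¹ * (classWeight χ c (w k) - N⁻¹ * ∑ i, w k i) ^ 2 ≤ F χ :=
    (Finset.single_le_sum (f := fun c => ((∑ i, w k i) ^ 2)⁻¹ *
      (classWeight χ c (w k) - N⁻¹ * ∑ i, w k i) ^ 2) (fun c _ => hnn k c)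
      (Finset.mem_univ c)).trans
      (Finset.single_le_sum (f := fun k => ∑ c, ((∑ i, w k i) ^ 2)⁻¹ *
        (classWeight χ c (w k) - N⁻¹ * ∑ i, w k i) ^ 2)
        (fun k _ => Finset.sum_nonneg fun c _ => hnn k c) (Finset.mem_univ k))
  have hWk := hWpos k
  have hsq : (classWeight χ c (w k) - N⁻¹ * ∑ i, w k i) ^ 2 ≤
      ((2 * N)⁻¹ * ∑ i, w k i) ^ 2 := by
    have := hterm.trans hle
    rw [inv_mul_le_iff₀ (by positivity)] at this
    rw [mul_pow]; linarith
  have habs := (abs_le_of_sq_le_sq' hsq (by positivity)).1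
  have hhalf : N⁻¹ * ∑ i, w k i = 2 * ((2 * N)⁻¹ * ∑ i, w k i) := by field_simp
  linarith

end RandomColouring

/-! ### Mean, relative variance and lower tail of a four-cycle count. -/

/-- What is used about a pattern `s` of dyad states: the mean of a coloured count is comparable to
the product of the weights of its colour classes, and its variance is at most `v E²`, where `E` is
the product `e ∏ᵣ ∑ᵢ wᵣᵢ` of the total weights. -/
structure PatternControl {n : ℕ} (θ : P1Param n) (s : Fin 4 → Bool × Bool) (e v : ℝ)
    (w : Fin 4 → Fin n → ℝ) : Prop where
  e_pos : 0 < e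
  v_nonneg : 0 ≤ v
  w_nonneg : ∀ r i, 0 ≤ w r i
  w_le_one : ∀ r i, w r i ≤ 1
  le_sum_w : ∀ r, 2304 ≤ ∑ i, w r i
  prob_le : ∀ S : Fin 4 → Fin n, ∏ r, θ.dyadProb (S r) (S (r + 1)) (s r) ≤ e * ∏ r, w r (S r)
  le_prob : ∀ S : Fin 4 → Fin n,
    (1 / 256) * (e * ∏ r, w r (S r)) ≤ ∏ r, θ.dyadProb (S r) (S (r + 1)) (s r)
  variance_le : ∀ (C : Type) [DecidableEq C] (χ : Fin n → C) (c : Fin 4 → C),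
    Function.Injective c →
    Ex θ.dyadLaw (fun ω => (colouredCount χ c s ω - Ex θ.dyadLaw (colouredCount χ c s)) ^ 2) ≤
      v * (e * ∏ r, ∑ i, w r i) ^ 2

namespace PatternControl

variable {n : ℕ} {θ : P1Param n} {s : Fin 4 → Bool × Bool} {e v : ℝ} {w : Fin 4 → Fin n → ℝ}
  (h : PatternControl θ s e v w)
include h

lemma total_pos : 0 < e * ∏ r, ∑ i, w r i :=
  mul_pos h.e_pos (Finset.prod_pos fun r _ => lt_of_lt_of_le (by norm_num) (h.le_sum_w r))

/-- The product of the class weights expands into the sum over the coloured quadruples. -/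
lemma le_Ex_colouredCount {C : Type} [DecidableEq C] (χ : Fin n → C) {c : Fin 4 → C}
    (hc : Function.Injective c) :
    (1 / 256) * (e * ∏ r, classWeight χ (c r) (w r)) ≤ Ex θ.dyadLaw (colouredCount χ c s) := by
  rw [θ.Ex_colouredCount hc]
  have h1 : ∏ r, classWeight χ (c r) (w r) =
      ∑ S : Fin 4 → Fin n, if IsColoured χ c S then ∏ r, w r (S r) else 0 := by
    unfold classWeight
    rw [Finset.prod_univ_sum, Fintype.piFinset_univ]
    refine Finset.sum_congr rfl fun S _ => ?_
    rw [Finset.prod_ite_zero]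
    simp [IsColoured]
  rw [h1, Finset.mul_sum, Finset.mul_sum]
  refine Finset.sum_le_sum fun S _ => ?_
  split_ifs
  · exact h.le_prob S
  · simp

lemma Ex_cycleCount_le : Ex θ.dyadLaw (cycleCount s) ≤ e * ∏ r, ∑ i, w r i := by
  unfold cycleCount
  rw [Ex_sum, Finset.prod_univ_sum, Fintype.piFinset_univ, Finset.mul_sum]
  refine Finset.sum_le_sum fun S _ => ?_
  split_ifs with hS
  · rw [θ.Ex_cycleInd s hS]; exact h.prob_le S
  · rw [θ.isProbFamily_dyadLaw.Ex_const]
    exact mul_nonneg h.e_pos.le (Finset.prod_nonneg fun r _ => h.w_nonneg r _)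

/-- There are three independent coloured counts of mean comparable to that of the full count. -/
lemma exists_blocks : ∃ χ : Fin n → Fin 3 × Fin 4, ∀ b : Fin 3,
    (1 / 96 ^ 4) * (e * ∏ r, ∑ i, w r i) ≤
      Ex θ.dyadLaw (colouredCount χ (fun r => (b, r)) s) := by
  -- Four weights and twelve colours require total weight 4·4·12² = 2304. Each class keeps at least
  -- 1/24 of every weight; with the 1/256 = 4⁻⁴ of `le_prob` this gives 96⁻⁴.
  obtain ⟨χ, hχ⟩ := exists_balanced_colouring (C := Fin 3 × Fin 4) w h.w_nonneg h.w_le_one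
    (fun k => le_trans (by norm_num) (h.le_sum_w k)) ⟨0⟩
  refine ⟨χ, fun b => le_trans ?_ (h.le_Ex_colouredCount χ (Prod.mk_right_injective b))⟩
  have h1 : ∏ r, ((24 : ℝ)⁻¹ * ∑ i, w r i) ≤ ∏ r, classWeight χ (b, r) (w r) := by
    refine Finset.prod_le_prod (fun r _ => mul_nonneg (by norm_num)
      (Finset.sum_nonneg fun i _ => h.w_nonneg r i)) fun r _ => ?_
    refine le_trans (le_of_eq ?_) (hχ r (b, r))
    norm_num
  rw [Finset.prod_mul_distrib] at h1
  have h2 := mul_le_mul_of_nonneg_left h1 h.e_pos.le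
  simp only [Finset.prod_const, Finset.card_univ, Fintype.card_fin] at h2
  linarith

lemma le_Ex_cycleCount :
    (1 / 96 ^ 4) * (e * ∏ r, ∑ i, w r i) ≤ Ex θ.dyadLaw (cycleCount s) := by
  obtain ⟨χ, hχ⟩ := h.exists_blocks
  exact (hχ 0).trans (θ.isProbFamily_dyadLaw.Ex_mono fun ω =>
    colouredCount_le (Prod.mk_right_injective 0) s ω)

lemma Ex_cycleCount_pos : 0 < Ex θ.dyadLaw (cycleCount s) :=
  lt_of_lt_of_le (mul_pos (by norm_num) h.total_pos) h.le_Ex_cycleCount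

/-- The relative variance of the full count. -/
lemma relative_variance_le :
    Ex θ.dyadLaw (fun ω => (cycleCount s ω / Ex θ.dyadLaw (cycleCount s) - 1) ^ 2) ≤
      256 ^ 2 * 96 ^ 8 * v := by
  have hq := h.Ex_cycleCount_pos
  set q := Ex θ.dyadLaw (cycleCount s) with hqdef
  set E := e * ∏ r, ∑ i, w r i
  have h1 : ∀ ω : Config n, (cycleCount s ω / q - 1) ^ 2 =
      (q ^ 2)⁻¹ * (cycleCount s ω - q) ^ 2 := fun ω => by field_simp
  simp only [h1]
  rw [Ex_const_mul, inv_mul_le_iff₀ (by positivity)]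
  refine (θ.variance_cycleCount_le s fun χ =>
    h.variance_le (Fin 4) χ id Function.injective_id).trans ?_
  have h2 : ((1 / 96 ^ 4) * E) ^ 2 ≤ q ^ 2 :=
    pow_le_pow_left₀ (mul_pos (by norm_num) h.total_pos).le h.le_Ex_cycleCount 2
  have hv := h.v_nonneg
  calc 256 ^ 2 * (v * E ^ 2) = 256 ^ 2 * 96 ^ 8 * v * ((1 / 96 ^ 4) * E) ^ 2 := by ring
    _ ≤ 256 ^ 2 * 96 ^ 8 * v * q ^ 2 := mul_le_mul_of_nonneg_left h2 (by positivity)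
    _ = _ := by ring

/-- Lower tail of the full count: all of three independent blocks would have to be small. -/
lemma lower_tail_le :
    Ex θ.dyadLaw (fun ω => if cycleCount s ω / Ex θ.dyadLaw (cycleCount s) < 1 / (2 * 96 ^ 4)
      then 1 else 0) ≤ (4 * 96 ^ 8 * v) ^ 3 := by
  have hp := θ.isProbFamily_dyadLaw
  have hq := h.Ex_cycleCount_pos
  obtain ⟨χ, hχ⟩ := h.exists_blocks
  set q := Ex θ.dyadLaw (cycleCount s) with hqdef
  set E := e * ∏ r, ∑ i, w r i with hE
  have hEpos : 0 < E := h.total_pos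
  have hqE : q ≤ E := h.Ex_cycleCount_le
  set G : Fin 3 → Config n → ℝ := fun b => colouredCount χ (fun r => (b, r)) s with hG
  -- Half of the guaranteed mean of a block, so Chebyshev's inequality gives v E²/t² = 4·96⁸ v.
  set t := 1 / (2 * 96 ^ 4) * E with ht
  have hpt : ∀ ω, (if cycleCount s ω / q < 1 / (2 * 96 ^ 4) then (1 : ℝ) else 0) ≤
      ∏ b, if G b ω < t then 1 else 0 := fun ω => by
    split_ifs with hω
    · have : ∀ b, G b ω < t := fun b => by
        refine (colouredCount_le (Prod.mk_right_injective b) s ω).trans_lt ?_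
        rw [div_lt_iff₀ hq] at hω
        exact hω.trans_le (mul_le_mul_of_nonneg_left hqE (by norm_num))
      simp [this]
    · exact Finset.prod_nonneg fun b _ => by split_ifs <;> norm_num
  refine (hp.Ex_mono hpt).trans ?_
  rw [hp.Ex_prod_of_dependsOn Finset.univ
    (D := fun b => {d | χ d.1.1 ∈ Set.range (fun r : Fin 4 => (b, r)) ∧
      χ d.1.2 ∈ Set.range (fun r : Fin 4 => (b, r))})
    (g := fun b ω => if G b ω < t then 1 else 0)]
  · have hb : ∀ b, Ex θ.dyadLaw (fun ω => if G b ω < t then (1 : ℝ) else 0) ≤ 4 * 96 ^ 8 * v := by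
      intro b
      have hm := hχ b
      have htm : t + t ≤ Ex θ.dyadLaw (G b) := by
        refine le_trans (le_of_eq ?_) hm
        rw [ht]; ring
      have ht0 : 0 < t := mul_pos (by norm_num) hEpos
      refine (hp.Ex_lower_tail (show t < Ex θ.dyadLaw (G b) by linarith)).trans ?_
      rw [div_le_iff₀ (pow_pos (by linarith) 2)]
      refine (h.variance_le _ χ _ (Prod.mk_right_injective b)).trans ?_
      have hv := h.v_nonneg
      calc v * E ^ 2 = 4 * 96 ^ 8 * v * t ^ 2 := by rw [ht]; ring
        _ ≤ 4 * 96 ^ 8 * v * (Ex θ.dyadLaw (G b) - t) ^ 2 := by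
          have : t ≤ Ex θ.dyadLaw (G b) - t := by linarith
          gcongr
    refine (Finset.prod_le_prod (fun b _ => hp.Ex_nonneg fun ω => by
      split_ifs <;> norm_num) fun b _ => hb b).trans (le_of_eq ?_)
    simp
  · intro b b' hbb
    rw [Set.disjoint_left]
    rintro d ⟨⟨r, hr⟩, -⟩ ⟨⟨r', hr'⟩, -⟩
    exact hbb (congrArg Prod.fst (hr.trans hr'.symm))
  · intro b x y hxy
    have : G b x = G b y := dependsOn_colouredCount s hxy
    simp only [this]

end PatternControl

/-! ### The two patterns in the p₁ model. -/

namespace P1Param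

variable {n : ℕ} (θ : P1Param n)

lemma mu_pos (i : Fin n) : 0 < θ.mu i := Real.exp_pos _

lemma nu_pos (i : Fin n) : 0 < θ.nu i := Real.exp_pos _

lemma eta_pos (i : Fin n) : 0 < θ.eta i := mul_pos (θ.mu_pos i) (θ.nu_pos i)

lemma mu_mul_nu (i j : Fin n) : θ.mu i * θ.nu j = Real.exp (θ.γ + θ.α i + θ.β j) := by
  rw [mu, nu, ← Real.exp_add]; congr 1; ring

lemma K_eq (i j : Fin n) : θ.K i j =
    (1 + θ.mu i * θ.nu j + θ.mu j * θ.nu i + Real.exp θ.ρ * θ.eta i * θ.eta j)⁻¹ := by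
  have : Real.exp θ.ρ * θ.eta i * θ.eta j =
      Real.exp (2 * θ.γ + θ.α i + θ.β j + θ.α j + θ.β i + θ.ρ) := by
    rw [eta, eta, mu_mul_nu, mu_mul_nu, ← Real.exp_add, ← Real.exp_add]; congr 1; ring
  rw [this, mu_mul_nu, mu_mul_nu, K]

lemma dyadProb_eq (i j : Fin n) (s : Bool × Bool) : θ.dyadProb i j s =
    θ.K i j * ((if s.1 then θ.mu i * θ.nu j else 1) * (if s.2 then θ.mu j * θ.nu i else 1) *
      (if s.1 && s.2 then Real.exp θ.ρ else 1)) := by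
  obtain ⟨a, b⟩ := s
  rw [dyadProb]
  cases a <;> cases b <;> simp [mu_mul_nu, Real.exp_add]

lemma dyadProb_patternA (r : Fin 4) (i j : Fin n) : θ.dyadProb i j (patternA r) =
    θ.K i j * patternBoundA (Real.exp θ.ρ) θ.mu θ.nu r i j := by
  rw [dyadProb_eq]
  fin_cases r <;> simp [patternA, patternBoundA] <;> left <;> ring

lemma dyadProb_patternB (r : Fin 4) (i j : Fin n) : θ.dyadProb i j (patternB r) =
    θ.K i j * patternBoundB θ.mu θ.nu r i j := by
  rw [dyadProb_eq]
  fin_cases r <;> simp [patternB, patternBoundB]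

/-- The weights of the four vertices of a pattern. -/
def patternWeight : Fin 4 → Fin n → ℝ := ![θ.eta, θ.eta, θ.nu, θ.mu]

lemma prod_patternBoundA (S : Fin 4 → Fin n) :
    ∏ r, patternBoundA (Real.exp θ.ρ) θ.mu θ.nu r (S r) (S (r + 1)) =
      Real.exp θ.ρ * ∏ r, θ.patternWeight r (S r) := by
  rw [Fin.prod_univ_four, Fin.prod_univ_four]
  simp only [patternBoundA, patternWeight, Matrix.cons_val, zero_add, two_add_one_fin_four, eta]
  ring

lemma prod_patternBoundB (S : Fin 4 → Fin n) :
    ∏ r, patternBoundB θ.mu θ.nu r (S r) (S (r + 1)) = 1 * ∏ r, θ.patternWeight r (S r) := by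
  rw [Fin.prod_univ_four, Fin.prod_univ_four]
  simp only [patternBoundB, patternWeight, Matrix.cons_val, zero_add, one_add_one_fin_four,
    three_add_one_fin_four, eta]
  ring

/-- The log-cross-ratio identity for the means. -/
lemma Ex_cycleCount_patternA : Ex θ.dyadLaw (cycleCount patternA) =
    Real.exp θ.ρ * Ex θ.dyadLaw (cycleCount patternB) := by
  unfold cycleCount
  rw [Ex_sum, Ex_sum, Finset.mul_sum]
  refine Finset.sum_congr rfl fun S _ => ?_
  split_ifs with hS
  · rw [θ.Ex_cycleInd _ hS, θ.Ex_cycleInd _ hS]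
    -- Both patterns run through the same four dyads, so the factors K agree; the remaining products
    -- are e^ρ and 1 times the same vertex weights η, η, ν, μ.
    simp only [dyadProb_patternA, dyadProb_patternB, Finset.prod_mul_distrib,
      prod_patternBoundA, prod_patternBoundB]
    ring
  · rw [θ.isProbFamily_dyadLaw.Ex_const, mul_zero]

/-- The bounds on a parameter that the variance estimates use. -/
structure Sparse : Prop where
  mu_le : ∀ i, θ.mu i ≤ 1
  nu_le : ∀ i, θ.nu i ≤ 1
  exp_eta_le : ∀ i j, Real.exp θ.ρ * θ.eta i * θ.eta j ≤ 1
  le_sum_eta : 2304 ≤ ∑ i, θ.eta i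

variable {θ}

/-- The normalizing sum consists of 1 and three positive terms that are at most 1. -/
lemma Sparse.K_bounds (h : θ.Sparse) (i j : Fin n) : 1 / 4 ≤ θ.K i j ∧ θ.K i j ≤ 1 := by
  have h1 : 0 < θ.mu i * θ.nu j := mul_pos (θ.mu_pos i) (θ.nu_pos j)
  have h2 : 0 < θ.mu j * θ.nu i := mul_pos (θ.mu_pos j) (θ.nu_pos i)
  have h3 : 0 < Real.exp θ.ρ * θ.eta i * θ.eta j :=
    mul_pos (mul_pos (Real.exp_pos _) (θ.eta_pos i)) (θ.eta_pos j)
  have h1' : θ.mu i * θ.nu j ≤ 1 := mul_le_one₀ (h.mu_le i) (θ.nu_pos j).le (h.nu_le j)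
  have h2' : θ.mu j * θ.nu i ≤ 1 := mul_le_one₀ (h.mu_le j) (θ.nu_pos i).le (h.nu_le i)
  have h3' := h.exp_eta_le i j
  rw [K_eq]
  refine ⟨?_, inv_le_one_of_one_le₀ (by linarith)⟩
  rw [one_div]
  exact inv_anti₀ (by linarith) (by linarith)

lemma Sparse.prod_bounds (h : θ.Sparse) (f : Fin 4 → Fin n → Fin n → ℝ) (s : Fin 4 → Bool × Bool)
    {e : ℝ} (he : 0 < e) (hf : ∀ r i j, θ.dyadProb i j (s r) = θ.K i j * f r i j)
    (hprod : ∀ S : Fin 4 → Fin n, ∏ r, f r (S r) (S (r + 1)) = e * ∏ r, θ.patternWeight r (S r))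
    (hw : ∀ r i, 0 ≤ θ.patternWeight r i) (S : Fin 4 → Fin n) :
    ∏ r, θ.dyadProb (S r) (S (r + 1)) (s r) ≤ e * ∏ r, θ.patternWeight r (S r) ∧
    (1 / 256) * (e * ∏ r, θ.patternWeight r (S r)) ≤ ∏ r, θ.dyadProb (S r) (S (r + 1)) (s r) := by
  have hnn : 0 ≤ e * ∏ r, θ.patternWeight r (S r) :=
    mul_nonneg he.le (Finset.prod_nonneg fun r _ => hw r _)
  simp only [hf, Finset.prod_mul_distrib, hprod]
  constructor
  · exact mul_le_of_le_one_left hnn (Finset.prod_le_one (fun r _ => θ.K_nonneg _ _)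
      fun r _ => (h.K_bounds _ _).2)
  · refine mul_le_mul_of_nonneg_right ?_ hnn
    have : ∏ _r : Fin 4, (1 / 4 : ℝ) ≤ ∏ r, θ.K (S r) (S (r + 1)) :=
      Finset.prod_le_prod (fun _ _ => by norm_num) fun r _ => (h.K_bounds _ _).1
    refine le_trans (le_of_eq ?_) this
    norm_num

lemma patternWeight_nonneg (r : Fin 4) (i : Fin n) : 0 ≤ θ.patternWeight r i := by
  fin_cases r
  exacts [(θ.eta_pos i).le, (θ.eta_pos i).le, (θ.nu_pos i).le, (θ.mu_pos i).le]

lemma Sparse.eta_le_mu (h : θ.Sparse) (i : Fin n) : θ.eta i ≤ θ.mu i :=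
  mul_le_of_le_one_right (θ.mu_pos i).le (h.nu_le i)

lemma Sparse.eta_le_nu (h : θ.Sparse) (i : Fin n) : θ.eta i ≤ θ.nu i :=
  mul_le_of_le_one_left (θ.nu_pos i).le (h.mu_le i)

lemma Sparse.patternWeight_le (h : θ.Sparse) (r : Fin 4) (i : Fin n) :
    θ.patternWeight r i ≤ 1 := by
  have h1 := (h.eta_le_mu i).trans (h.mu_le i)
  fin_cases r
  exacts [h1, h1, h.nu_le i, h.mu_le i]

lemma Sparse.le_sum_patternWeight (h : θ.Sparse) (r : Fin 4) :
    2304 ≤ ∑ i, θ.patternWeight r i := by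
  have h1 := h.le_sum_eta
  have h2 := h1.trans (Finset.sum_le_sum fun i _ => h.eta_le_mu i)
  have h3 := h1.trans (Finset.sum_le_sum fun i _ => h.eta_le_nu i)
  fin_cases r
  exacts [h1, h1, h3, h2]

variable (θ) in
lemma l1norm_eta : l1norm θ.eta = ∑ i, θ.eta i :=
  Finset.sum_congr rfl fun i _ => abs_of_pos (θ.eta_pos i)

lemma Sparse.one_le_rate_mul (h : θ.Sparse) :
    1 ≤ θ.rate * (Real.exp θ.ρ * (∑ i, θ.mu i * θ.nu i) ^ 2) := by
  have h1 : 1 / (Real.exp θ.ρ * l1norm θ.eta ^ 2) ≤ θ.rate := le_max_left _ _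
  have h2 := h.le_sum_eta
  rw [l1norm_eta, div_le_iff₀ (mul_pos (Real.exp_pos _) (pow_pos (by linarith) 2))] at h1
  exact h1

lemma Sparse.dot_mul_dot_le (h : θ.Sparse) :
    (∑ i, θ.mu i * (θ.mu i * θ.nu i)) * (∑ i, θ.nu i * (θ.mu i * θ.nu i)) ≤
      θ.rate * (∑ i, θ.mu i * θ.nu i) ^ 4 := by
  have h1 : (θ.mu ⬝ᵥ θ.eta) * (θ.nu ⬝ᵥ θ.eta) / l1norm θ.eta ^ 4 ≤ θ.rate := le_max_right _ _
  have h2 := h.le_sum_eta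
  rw [l1norm_eta, div_le_iff₀ (pow_pos (by linarith) 4)] at h1
  exact h1

lemma Sparse.rate_nonneg (h : θ.Sparse) : 0 ≤ θ.rate := by
  have h1 := h.one_le_rate_mul
  have h2 : 0 ≤ Real.exp θ.ρ * (∑ i, θ.mu i * θ.nu i) ^ 2 := by positivity
  by_contra hlt
  nlinarith [mul_nonneg (neg_nonneg.2 (not_le.1 hlt).le) h2]

lemma Sparse.patternControlA (h : θ.Sparse) :
    PatternControl θ patternA (Real.exp θ.ρ) (15 * θ.rate) θ.patternWeight where
  e_pos := Real.exp_pos _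
  v_nonneg := mul_nonneg (by norm_num) h.rate_nonneg
  w_nonneg := patternWeight_nonneg
  w_le_one := h.patternWeight_le
  le_sum_w := h.le_sum_patternWeight
  prob_le S := (h.prod_bounds _ _ (Real.exp_pos _) θ.dyadProb_patternA θ.prod_patternBoundA
    patternWeight_nonneg S).1
  le_prob S := (h.prod_bounds _ _ (Real.exp_pos _) θ.dyadProb_patternA θ.prod_patternBoundA
    patternWeight_nonneg S).2
  variance_le C _ χ c hc := by
    refine (θ.variance_colouredCount_le hc patternA
      (patternBoundA (Real.exp θ.ρ) θ.mu θ.nu) fun r i j => ?_).trans ?_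
    · rw [dyadProb_patternA]
      refine mul_le_of_le_one_left ?_ (h.K_bounds i j).2
      have h1 := (θ.eta_pos i).le
      have h2 := (θ.eta_pos j).le
      fin_cases r
      exacts [mul_nonneg (mul_nonneg (Real.exp_pos _).le h1) h2, zero_le_one,
        mul_nonneg (θ.nu_pos i).le (θ.mu_pos j).le, zero_le_one]
    · refine (variance_sum_patternA_le (fun i => (θ.mu_pos i).le) (fun i => (θ.nu_pos i).le)
        h.mu_le h.nu_le (le_trans (by norm_num) h.le_sum_eta) (Real.exp_pos _) h.dot_mul_dot_le
        h.one_le_rate_mul).trans (le_of_eq ?_)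
      rw [Fin.prod_univ_four]
      simp only [patternWeight, Matrix.cons_val, eta]
      ring

lemma Sparse.patternControlB (h : θ.Sparse) :
    PatternControl θ patternB 1 (15 * θ.rate) θ.patternWeight where
  e_pos := one_pos
  v_nonneg := mul_nonneg (by norm_num) h.rate_nonneg
  w_nonneg := patternWeight_nonneg
  w_le_one := h.patternWeight_le
  le_sum_w := h.le_sum_patternWeight
  prob_le S := (h.prod_bounds _ _ one_pos θ.dyadProb_patternB θ.prod_patternBoundB
    patternWeight_nonneg S).1
  le_prob S := (h.prod_bounds _ _ one_pos θ.dyadProb_patternB θ.prod_patternBoundB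
    patternWeight_nonneg S).2
  variance_le C _ χ c hc := by
    refine (θ.variance_colouredCount_le hc patternB
      (patternBoundB θ.mu θ.nu) fun r i j => ?_).trans ?_
    · rw [dyadProb_patternB]
      refine mul_le_of_le_one_left ?_ (h.K_bounds i j).2
      have h1 := (mul_pos (θ.mu_pos i) (θ.nu_pos j)).le
      fin_cases r
      exacts [h1, h1, zero_le_one, h1]
    · refine (variance_sum_patternB_le (fun i => (θ.mu_pos i).le) (fun i => (θ.nu_pos i).le)
        h.mu_le h.nu_le (le_trans (by norm_num) h.le_sum_eta) h.dot_mul_dot_le).trans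
        (le_of_eq ?_)
      rw [Fin.prod_univ_four]
      simp only [patternWeight, Matrix.cons_val, eta]
      ring

end P1Param

/-! ### Risk of the LCR estimator. -/

lemma le_maxEntry {n : ℕ} (x : Fin n → ℝ) (i : Fin n) : x i ≤ maxEntry x :=
  le_ciSup (Set.finite_range x).bddAbove i

/-- For the bound on ρ: both ‖η‖₁ and e^{ρ/2}‖η‖₁ lie between 1 and n, so e^{ρ/2} lies between 1/n
and n. This is why the threshold 2 log n is harmless. -/
lemma Theta0_sparse {n : ℕ} {θ : P1Param n} (hθ : θ ∈ Theta0 n) (hn : 0 < n)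
    (hL : 1 ≤ Real.log (Real.log n)) (hlog : 2304 ≤ Real.log n) :
    θ.Sparse ∧ |θ.ρ| ≤ 2 * Real.log n := by
  obtain ⟨h1, h2, h3, h4, h5, -⟩ := hθ
  have hn0 : (0 : ℝ) < n := by exact_mod_cast hn
  have le_one : ∀ x : ℝ, 0 < x → Real.log (Real.log n) ≤ 1 / x → x ≤ 1 := fun x hx h => by
    rw [le_div_iff₀ hx] at h; nlinarith
  have i₀ : Fin n := ⟨0, hn⟩
  have mpos : 0 < maxEntry θ.mu := (θ.mu_pos i₀).trans_le (le_maxEntry _ i₀)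
  have npos : 0 < maxEntry θ.nu := (θ.nu_pos i₀).trans_le (le_maxEntry _ i₀)
  have epos : 0 < maxEntry θ.eta := (θ.eta_pos i₀).trans_le (le_maxEntry _ i₀)
  have hm : ∀ i, θ.mu i ≤ 1 := fun i => (le_maxEntry _ i).trans (le_one _ mpos h1)
  have hv : ∀ i, θ.nu i ≤ 1 := fun i => (le_maxEntry _ i).trans (le_one _ npos h2)
  have hx0 := Real.exp_pos (θ.ρ / 2)
  have he := le_one _ (mul_pos hx0 epos) h3
  have he' : ∀ i, Real.exp (θ.ρ / 2) * θ.eta i ≤ 1 := fun i =>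
    (mul_le_mul_of_nonneg_left (le_maxEntry _ i) hx0.le).trans he
  rw [θ.l1norm_eta] at h4 h5
  have hH : Real.log n ^ 2 ≤ ∑ i, θ.eta i := by
    rw [le_div_iff₀ (by positivity)] at h4
    nlinarith [sq_nonneg (Real.log n)]
  have hxH : 1 ≤ Real.exp (θ.ρ / 2) * ∑ i, θ.eta i := by
    have hs : 1 ≤ √(Real.log n) := Real.one_le_sqrt.2 (by linarith)
    rw [le_div_iff₀ (by positivity)] at h5
    nlinarith
  have hHn : ∑ i, θ.eta i ≤ n := by
    calc ∑ i, θ.eta i ≤ ∑ _i : Fin n, (1 : ℝ) := Finset.sum_le_sum fun i _ =>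
          mul_le_one₀ (hm i) (θ.nu_pos i).le (hv i)
      _ = n := by simp
  have hxHn : Real.exp (θ.ρ / 2) * ∑ i, θ.eta i ≤ n := by
    rw [Finset.mul_sum]
    calc ∑ i, Real.exp (θ.ρ / 2) * θ.eta i ≤ ∑ _i : Fin n, (1 : ℝ) :=
          Finset.sum_le_sum fun i _ => he' i
      _ = n := by simp
  refine ⟨⟨hm, hv, fun i j => ?_, by nlinarith⟩, ?_⟩
  · have hhalf : Real.exp θ.ρ = Real.exp (θ.ρ / 2) * Real.exp (θ.ρ / 2) := by
      rw [← Real.exp_add]; congr 1; ring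
    calc Real.exp θ.ρ * θ.eta i * θ.eta j
        = (Real.exp (θ.ρ / 2) * θ.eta i) * (Real.exp (θ.ρ / 2) * θ.eta j) := by rw [hhalf]; ring
      _ ≤ 1 := mul_le_one₀ (he' i) (mul_pos hx0 (θ.eta_pos j)).le (he' j)
  · have hup : Real.exp (θ.ρ / 2) ≤ n := by
      refine le_trans ?_ hxHn
      exact le_mul_of_one_le_right hx0.le (by nlinarith)
    have hlow : 1 ≤ Real.exp (θ.ρ / 2) * n := hxH.trans (mul_le_mul_of_nonneg_left hHn hx0.le)
    have l1 := Real.log_le_log hx0 hup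
    have l2 := Real.log_le_log one_pos hlow
    rw [Real.log_exp] at l1
    rw [Real.log_one, Real.log_mul hx0.ne' hn0.ne', Real.log_exp] at l2
    rw [abs_le]; constructor <;> linarith

lemma abs_H_le (x : ℝ) {t : ℝ} (ht : 0 ≤ t) : |H x t| ≤ t := by
  unfold H
  split_ifs with h
  · exact h
  · rcases lt_trichotomy x 0 with hx | hx | hx
    · rw [Real.sign_of_neg hx]; simp [abs_of_nonneg ht]
    · simp [hx, ht]
    · rw [Real.sign_of_pos hx]; simp [abs_of_nonneg ht]

/-- Thresholding at a level that exceeds `|y|` does not increase the distance to `y`. -/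
lemma H_sub_sq_le (x : ℝ) {y t : ℝ} (hy : |y| ≤ t) : (H x t - y) ^ 2 ≤ (x - y) ^ 2 := by
  unfold H
  split_ifs with h
  · exact le_rfl
  · obtain ⟨h1, h2⟩ := abs_le.1 hy
    rcases lt_or_ge x 0 with hx | hx
    · rw [Real.sign_of_neg hx]
      rw [abs_of_neg hx] at h
      nlinarith
    · rw [abs_of_nonneg hx] at h
      have hx' : 0 < x := by linarith [abs_nonneg y]
      rw [Real.sign_of_pos hx']
      nlinarith

lemma abs_lcr_le {n : ℕ} (A : Matrix (Fin n) (Fin n) ℝ) : |lcr A| ≤ 2 * Real.log n := by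
  have h : 0 ≤ 2 * Real.log (n : ℝ) := mul_nonneg zero_le_two (Real.log_natCast_nonneg n)
  unfold lcr
  split_ifs
  · simpa using h
  · exact (abs_of_nonneg h).le
  · rw [abs_neg]; exact (abs_of_nonneg h).le
  · exact abs_H_le _ h

/-- From 1 - 1/x ≤ log x ≤ x - 1: the logarithm is at most |x - 1| / min(1, x) in absolute value. -/
lemma log_sq_le {x c : ℝ} (hc : 0 < c) (hc1 : c ≤ 1) (hx : c ≤ x) :
    Real.log x ^ 2 ≤ (c ^ 2)⁻¹ * (x - 1) ^ 2 := by
  have hx0 : 0 < x := hc.trans_le hx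
  rw [← div_eq_inv_mul, le_div_iff₀ (by positivity), ← mul_pow]
  have h1 := Real.log_le_sub_one_of_pos hx0
  have h2 := Real.one_sub_inv_le_log_of_pos hx0
  have h2' : x - 1 ≤ x * Real.log x := by
    have := mul_le_mul_of_nonneg_left h2 hx0.le
    rwa [mul_sub, mul_inv_cancel₀ hx0.ne', mul_one] at this
  rcases le_total 1 x with h | h
  · have h3 := Real.log_nonneg h
    exact pow_le_pow_left₀ (mul_nonneg h3 hc.le) (by nlinarith) 2
  · have h3 := Real.log_nonpos hx0.le h
    rw [← neg_sq, ← neg_sq (x - 1)]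
    exact pow_le_pow_left₀ (by nlinarith) (by nlinarith) 2

/-- Pointwise bound for the loss of the LCR estimator. -/
lemma lcr_sub_sq_le {n : ℕ} (A : Matrix (Fin n) (Fin n) ℝ) {ρ qa qb c : ℝ} (hqb : 0 < qb)
    (hqa : qa = Real.exp ρ * qb) (hρ : |ρ| ≤ 2 * Real.log n) (hc : 0 < c) (hc1 : c ≤ 1) :
    (lcr A - ρ) ^ 2 ≤ 2 * (c ^ 2)⁻¹ * ((Qa A / qa - 1) ^ 2 + (Qb A / qb - 1) ^ 2) +
      16 * Real.log n ^ 2 * ((if Qa A / qa < c then 1 else 0) + if Qb A / qb < c then 1 else 0) := by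
  have hqa0 : 0 < qa := by rw [hqa]; exact mul_pos (Real.exp_pos _) hqb
  have hbad : (lcr A - ρ) ^ 2 ≤ 16 * Real.log n ^ 2 := by
    obtain ⟨h1, h2⟩ := abs_le.1 (abs_lcr_le A)
    obtain ⟨h3, h4⟩ := abs_le.1 hρ
    nlinarith
  have hnn : 0 ≤ 2 * (c ^ 2)⁻¹ * ((Qa A / qa - 1) ^ 2 + (Qb A / qb - 1) ^ 2) := by positivity
  have hnn' : 0 ≤ 16 * Real.log n ^ 2 := by positivity
  by_cases ha : Qa A / qa < c
  · rw [if_pos ha]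
    split_ifs <;> linarith
  by_cases hb : Qb A / qb < c
  · rw [if_pos hb, if_neg ha]
    linarith
  rw [if_neg ha, if_neg hb]
  rw [not_lt] at ha hb
  have hQa : 0 < Qa A := by
    have := hc.trans_le ha
    rwa [div_pos_iff_of_pos_right hqa0] at this
  have hQb : 0 < Qb A := by
    have := hc.trans_le hb
    rwa [div_pos_iff_of_pos_right hqb] at this
  have hl : lcr A = H (Real.log (Qa A / Qb A)) (2 * Real.log n) := by
    unfold lcr
    rw [if_neg (fun h => hQa.ne' h.1), if_neg hQb.ne', if_neg hQa.ne']
  -- The identity between the means makes ρ equal to log(qa/qb).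
  have e1 : Real.log (Qa A / Qb A) - ρ = Real.log (Qa A / qa) - Real.log (Qb A / qb) := by
    rw [Real.log_div hQa.ne' hQb.ne', Real.log_div hQa.ne' hqa0.ne', Real.log_div hQb.ne' hqb.ne',
      hqa, Real.log_mul (Real.exp_pos _).ne' hqb.ne', Real.log_exp]
    ring
  have e2 := log_sq_le hc hc1 ha
  have e3 := log_sq_le hc hc1 hb
  calc (lcr A - ρ) ^ 2 ≤ (Real.log (Qa A / Qb A) - ρ) ^ 2 := by
        rw [hl]; exact H_sub_sq_le _ hρ
    _ ≤ 2 * (Real.log (Qa A / qa) ^ 2 + Real.log (Qb A / qb) ^ 2) := by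
        rw [e1]; nlinarith [sq_nonneg (Real.log (Qa A / qa) + Real.log (Qb A / qb))]
    _ ≤ _ := by linarith

/-- The constant of the upper bound. -/
def riskConstant : ℝ :=
  2 * (((1 / (2 * 96 ^ 4) : ℝ)) ^ 2)⁻¹ * (2 * (256 ^ 2 * 96 ^ 8 * 15)) +
    16 * (2 * (4 * 96 ^ 8 * 15) ^ 3)

lemma riskConstant_pos : 0 < riskConstant := by unfold riskConstant; positivity

/-- Mean squared error of the LCR estimator at a sparse parameter. -/
lemma P1Param.Sparse.Ex_lcr_le {n : ℕ} {θ : P1Param n} (h : θ.Sparse)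
    (hρ : |θ.ρ| ≤ 2 * Real.log n) (hr : Real.log n * θ.rate ≤ 1) :
    Ex θ.dyadLaw (fun ω => (lcr (adjacency ω) - θ.ρ) ^ 2) ≤ riskConstant * θ.rate := by
  have hp := θ.isProbFamily_dyadLaw
  have hA := h.patternControlA
  have hB := h.patternControlB
  set qa := Ex θ.dyadLaw (cycleCount patternA) with hqa
  set qb := Ex θ.dyadLaw (cycleCount patternB) with hqb
  have hpt : ∀ ω : Config n, _ := fun ω => lcr_sub_sq_le (adjacency ω) (c := 1 / (2 * 96 ^ 4))
    hB.Ex_cycleCount_pos θ.Ex_cycleCount_patternA hρ (by norm_num) (by norm_num)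
  simp only [Qa_adjacency, Qb_adjacency, ← hqa, ← hqb] at hpt
  refine (hp.Ex_mono hpt).trans ?_
  rw [Ex_add, Ex_const_mul, Ex_const_mul, Ex_add, Ex_add]
  have v1 := hA.relative_variance_le
  have v2 := hB.relative_variance_le
  have t1 := hA.lower_tail_le
  have t2 := hB.lower_tail_le
  rw [← hqa] at v1 t1
  rw [← hqb] at v2 t2
  set r := θ.rate
  have hr0 : 0 ≤ r := h.rate_nonneg
  -- The reason for three blocks: the cubed tail absorbs the loss log² n using only r log n ≤ 1,
  -- whereas a squared tail would need r log² n bounded.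
  have hlr : Real.log n ^ 2 * r ^ 3 ≤ r := by
    have h1 : (Real.log n * r) ^ 2 ≤ 1 :=
      pow_le_one₀ (mul_nonneg (Real.log_natCast_nonneg n) hr0) hr
    calc Real.log n ^ 2 * r ^ 3 = (Real.log n * r) ^ 2 * r := by ring
      _ ≤ r := mul_le_of_le_one_left hr0 h1
  refine (add_le_add (mul_le_mul_of_nonneg_left (add_le_add v1 v2) (by positivity))
    (mul_le_mul_of_nonneg_left (add_le_add t1 t2) (by positivity))).trans ?_
  have h2 := mul_le_mul_of_nonneg_left hlr
    (show (0 : ℝ) ≤ 16 * (2 * (4 * 96 ^ 8 * 15) ^ 3) by positivity)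
  unfold riskConstant
  linarith

lemma worstRisk_lcr_le {cL κ ε : ℝ} {n : ℕ} (hn : 0 < n)
    (hL : 1 ≤ Real.log (Real.log n)) (hlog : 2304 ≤ Real.log n)
    (hε' : ε ≤ 1 / (Real.log n * Real.log (Real.log n) ^ 2)) :
    worstRisk cL κ n ε lcr ≤ ENNReal.ofReal (riskConstant * ε) := by
  refine iSup₂_le fun θ hθ => ?_
  obtain ⟨h0, hr, -⟩ := hθ
  obtain ⟨hs, hρ⟩ := Theta0_sparse h0 hn hL hlog
  rw [θ.mse_eq]
  refine ENNReal.ofReal_le_ofReal ((hs.Ex_lcr_le hρ ?_).trans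
    (mul_le_mul_of_nonneg_left hr riskConstant_pos.le))
  rw [le_div_iff₀ (by positivity)] at hε'
  have h1 : Real.log n * θ.rate * 1 ≤ Real.log n * θ.rate * Real.log (Real.log n) ^ 2 :=
    mul_le_mul_of_nonneg_left (one_le_pow₀ hL) (mul_nonneg (by linarith) hs.rate_nonneg)
  have h2 : θ.rate * (Real.log n * Real.log (Real.log n) ^ 2) ≤
      ε * (Real.log n * Real.log (Real.log n) ^ 2) :=
    mul_le_mul_of_nonneg_right hr (by positivity)
  linarith

end

theorem theorem3p3 (cL κ : ℝ) (hcL : 0 < cL) (hκ : 1 ≤ κ) :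
    ∃ c C : ℝ, 0 < c ∧ 0 < C ∧
      -- upper bound, for all `ε` from `(log log n / n)²` on
      (∀ᶠ n : ℕ in atTop, ∀ ε : ℝ,
        (Real.log (Real.log n) / n) ^ 2 ≤ ε →
        ε ≤ 1 / (Real.log n * Real.log (Real.log n) ^ 2) →
          minimaxRisk cL κ n ε ≤ worstRisk cL κ n ε lcr ∧
          worstRisk cL κ n ε lcr ≤ ENNReal.ofReal (C * ε)) ∧
      -- lower bound, away from the left end point by a factor `1 + δ`
      (∀ δ : ℝ, 0 < δ → ∀ᶠ n : ℕ in atTop, ∀ ε : ℝ,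
        (1 + δ) * (Real.log (Real.log n) / n) ^ 2 ≤ ε →
        ε ≤ 1 / (Real.log n * Real.log (Real.log n) ^ 2) →
          ENNReal.ofReal (c * ε) ≤ minimaxRisk cL κ n ε) := by
  refine ⟨Real.exp (-1) / 4, riskConstant, by positivity, riskConstant_pos, ?_,
    minimaxRisk_lower_eventually cL κ hκ⟩
  filter_upwards [eventually_one_le_log_log 1, eventually_gt_atTop 0,
    (Real.tendsto_log_atTop.comp tendsto_natCast_atTop_atTop).eventually_ge_atTop 2304]
    with n hL hn hlog ε _ hε'
  exact ⟨iInf_le _ lcr, worstRisk_lcr_le hn hL hlog hε'⟩
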